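/- Let $\zeta$ be the Riemann zeta-function, $\gamma$ Euler's constant, $\Psi=\Gamma'/\Gamma$ the digamma function, $A=e^{1/12-\zeta'(-1)}$ the Glaisher–Kinkelin constant, $\gamma_1=\lim_{N\to\infty}\big(\sum_{n=1}^N \frac{\ln n}{n}-\frac{\ln^2 N}{2}\big)$ the first Stieltjes constant, and $\kappa_1=\sum_{n\ge1}\frac{|G_n|}{n^2}$, where Gregory's coefficients $G_n$ are given by $\frac{z}{\ln(1+z)}=1+\sum_{n\ge1}G_nz^n$. For an integer $k\ge-1$ put $$\nu_k=\sum_{j=2}^{\infty}(-1)^j\frac{\zeta(j)}{j+k}$$ (a convergent series, summed in its natural order). All integrals below converge absolutely, and every equality with a sign $\pm$ holds for both choices of the sign (the same throughout each integrand). (a) For every integer $k\ge0$, $$\int_{-\infty}^{+\infty}\frac{\zeta(\frac12\pm ix)}{(\frac12\pm ix+k)\cosh\pi x}\,dx=2\Big(-\frac1{(k+1)^2}+\frac{\gamma}{k+1}-\nu_k\Big),$$ and for every integer $k\ge-1$, $$\int_{-\infty}^{+\infty}\frac{\zeta(\frac32\pm ix)}{(\frac32\pm ix+k)\cosh\pi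 x}\,dx=2\nu_k .$$ These integrals have closed forms for all integers $k\ge 0$, because $\nu_0=\gamma$ and, for every integer $k\ge1$, $$\nu_k=\frac{\gamma}{k+1}+\frac1k+\sum_{m=0}^{k-1}(-1)^m\binom km\big(\zeta'(-m)+H_m\,\zeta(-m)\big),\qquad H_m=\sum_{i=1}^m\frac1i .$$ (b) In particular, $$\int_{-\infty}^{+\infty}\frac{\zeta(\frac12\pm ix)}{(\frac12\pm ix)\cosh\pi x}\,dx=-2,$$ $$\int_{-\infty}^{+\infty}\frac{\zeta(\frac12\pm ix)}{(\frac32\pm ix)\cosh\pi x}\,dx=\ln2\pi-\frac52,$$ $$\int_{-\infty}^{+\infty}\frac{\zeta(\frac12\pm ix)}{(\frac52\pm ix)\cosh\pi x}\,dx=\ln2\pi-4\ln A-\frac{11}9,$$ $$\int_{-\infty}^{+\infty}\frac{\zeta(\frac32\pm ix)}{(\frac32\pm ix)\cosh\pi x}\,dx=2\gamma,$$ $$\int_{-\infty}^{+\infty}\frac{\zeta(\frac32\pm ix)}{(\frac12\pm ix)\cosh\pi x}\,dx=2\int_0^1\frac{\Psi(x+1)+\gamma}{x}\,dx=2\kappa_1+\frac{\pi^2}6-\gamma^2-2\gamma_1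 .$$ -/

import Mathlib

namespace ZetaSeries

/-- The partial sums `∑_{j=2}^{N} (-1)^j ζ(j) / (j + k)`. -/
noncomputable def nuPartial (k : ℤ) (N : ℕ) : ℂ :=
  ∑ j ∈ Finset.Icc 2 N, (-1 : ℂ) ^ j * riemannZeta (j : ℂ) / ((j : ℂ) + (k : ℂ))

/-- `ν_k = ∑_{j ≥ 2} (-1)^j ζ(j) / (j + k)`. The series converges only conditionally, so it is the
limit of its partial sums (and not an unconditional `tsum`). -/
noncomputable def nu (k : ℤ) : ℂ :=
  Filter.limUnder Filter.atTop (nuPartial k)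

/-- The integrand `ζ(σ + i ε x) / ((σ + i ε x + ω) cosh (π x))`; the sign `±` is `ε = 1` or
`ε = -1`. -/
noncomputable def kernel (σ ε : ℝ) (ω : ℂ) (x : ℝ) : ℂ :=
  riemannZeta ((σ : ℂ) + Complex.I * ε * x) /
    (((σ : ℂ) + Complex.I * ε * x + ω) * Complex.cosh (Real.pi * x))

/-- The Glaisher-Kinkelin constant `A = exp (1/12 - ζ'(-1))`. -/
noncomputable def glaisherKinkelin : ℝ :=
  Real.exp (1 / 12 - (deriv riemannZeta (-1)).re)

/-- `∑_{i=1}^{N} (ln i)^m / i - (ln N)^(m+1) / (m+1)`. -/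
noncomputable def stieltjesSeq (m N : ℕ) : ℝ :=
  ∑ i ∈ Finset.Icc 1 N, Real.log i ^ m / i - Real.log N ^ (m + 1) / (m + 1)

/-- The Stieltjes constants `γ_m`. -/
noncomputable def stieltjes (m : ℕ) : ℝ :=
  Filter.limUnder Filter.atTop (stieltjesSeq m)

/-- Gregory's coefficients `G_n`, given by the generating function
`z / ln (1 + z) = 1 + ∑_{n ≥ 1} G_n z ^ n`: the formal power series inverse of
`ln (1 + z) / z = ∑_{m ≥ 0} (-1)^m z^m / (m + 1)`. -/
noncomputable def gregory (n : ℕ) : ℝ :=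
  PowerSeries.coeff n (PowerSeries.mk fun m : ℕ => (-1 : ℝ) ^ m / ((m : ℝ) + 1))⁻¹

/-- `κ₁ = ∑_{n ≥ 1} |G_n| / n²`. -/
noncomputable def kappaOne : ℝ :=
  ∑' n : ℕ, |gregory (n + 1)| / ((n : ℝ) + 1) ^ 2

end ZetaSeries

/-!
All the integrals reduce to the moments
`∫₀¹ u^k (Ψ(1 + u) + γ) du = ∑_n ∫₀¹ u^(k+1) / (n (n + u)) du` of the digamma function (`nuReal`,
indexed by `p = k + 1`). Expanding `1 / (n + u)` geometrically in `u / n` shows that `ν_k` is this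
moment (`tendsto_nuPartial`), and that `ν_0 = γ`.

For the integrals, `1 / cosh (π x)` is its own Fourier transform, by the Beta integral
`B(s, 1 - s) = π / sin (π s)` on the critical line. Together with
`1 / (s + k) = ∫₀¹ u^(s+k-1) du` and Fubini this gives
`∫ y^s / ((s + k) cosh (π x)) dx = 2 ∫₀¹ u^k y / (1 + u y) du` on `Re s = 1/2`
(`integral_cpow_div_mul_sechWeight`). On `Re s = 3/2` the Dirichlet series of `ζ` is integrated term
by term; on `Re s = 1/2` the same is done with `∑_{n ≤ N} n^(-s) - N^(1-s) / (1 - s) → ζ(s)` and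
dominated convergence.

The closed form of `ν_k` comes from `∑_n ∫₀¹ u^k (n + u)^(-s) du`. Repeated integration by parts
expresses it for large `Re s` through `ζ(s - 1), …, ζ(s - k)`, and the identity theorem carries this
down to `Re s > 1` (`shiftProd_mul_momentSeries`). As `s → 1+`, the difference
`ζ(s) / (k + 1) - ∑_n ∫₀¹ u^k (n + u)^(-s) du` tends to `ν_k`; hence the polar terms cancel, and the
constant term of the Laurent expansion is `ν_k` (`nuReal_succ_eq_deriv_polarPart`). The case `k = 1`
of the continuation also gives the formula for `ζ` on `Re s > 0` that the integrals use.

For `ν_{-1} = ∑_n ln (1 + 1/n) / n`, the double series `∑_{m,n} |G_m| B(m, n + 1) / n` is summed in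
both orders. The sum over `n` of `B(m, n + 1) / n` telescopes to `1 / m²`; the sum over `m` of
`|G_m| B(m, n + 1)` is `∫₀¹ (1 - z)^n (1 / z + 1 / ln (1 - z)) dz = γ + ln (n + 1) - H_n`. So
`κ₁ = ∑_n (γ + ln (n + 1) - H_n) / n` (`hasSum_kappaOne`), and comparing partial sums expresses `κ₁`
by `ν_{-1}`, `γ`, `π²` and `γ₁`, and shows that the limit `γ₁` exists.
-/

namespace ZetaSeries

open Filter Topology MeasureTheory Finset

/-! ### Gregory's coefficients and Beta integrals -/

/-- The signed Gregory coefficient `(-1)^n G_{n+1}`, which turns out to be `|G_{n+1}|`. -/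
noncomputable def absGregory (n : ℕ) : ℝ := (-1) ^ n * gregory (n + 1)

lemma gregory_zero : gregory 0 = 1 := by
  simp [gregory, PowerSeries.coeff_inv]

/-- The recurrence that says that the Gregory series is inverse to the logarithmic one. -/
lemma sum_absGregory_div (n : ℕ) :
    ∑ i ∈ range (n + 1), absGregory i / ((n - i : ℕ) + 1 : ℝ) = 1 / (n + 2) := by
  set A : PowerSeries ℝ := PowerSeries.mk fun m : ℕ => (-1 : ℝ) ^ m / ((m : ℝ) + 1) with hA
  have h1 : A⁻¹ * A = 1 := PowerSeries.inv_mul_cancel _ (by simp [hA])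
  have h2 := congrArg (PowerSeries.coeff (n + 1)) h1
  rw [PowerSeries.coeff_mul, Finset.Nat.sum_antidiagonal_succ] at h2
  simp only [PowerSeries.coeff_one, Nat.add_eq_zero_iff, one_ne_zero, and_false, if_false] at h2
  have h3 : ∀ i, PowerSeries.coeff i A⁻¹ = gregory i := fun i => rfl
  simp only [h3, gregory_zero] at h2
  simp only [hA, PowerSeries.coeff_mk] at h2
  rw [Finset.Nat.sum_antidiagonal_eq_sum_range_succ
    (fun i j => gregory (i + 1) * ((-1 : ℝ) ^ j / ((j : ℝ) + 1)))] at h2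
  have h4 : ∑ i ∈ range (n + 1), absGregory i / ((n - i : ℕ) + 1 : ℝ)
      = (-1) ^ n * ∑ i ∈ range (n + 1),
        gregory (i + 1) * ((-1 : ℝ) ^ (n - i) / ((n - i : ℕ) + 1 : ℝ)) := by
    rw [Finset.mul_sum]
    refine Finset.sum_congr rfl fun i hi => ?_
    have hi' : i ≤ n := Nat.lt_succ_iff.1 (mem_range.1 hi)
    have h5 : (-1 : ℝ) ^ n = (-1) ^ i * (-1) ^ (n - i) := by
      rw [← pow_add]; congr 1; omega
    have h6 : (-1 : ℝ) ^ (n - i) * (-1) ^ (n - i) = 1 := by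
      rw [← mul_pow]; simp
    rw [h5, absGregory]
    linear_combination (-(gregory (i + 1) * (-1) ^ i / ((n - i : ℕ) + 1 : ℝ))) * h6
  have h6 : (-1 : ℝ) ^ n * (-1) ^ n = 1 := by
    rw [← mul_pow]; simp
  rw [h4, eq_neg_of_add_eq_zero_right h2, pow_succ]
  push_cast
  have : (n : ℝ) + 2 ≠ 0 := by positivity
  have : (n : ℝ) + 1 + 1 ≠ 0 := by positivity
  field_simp
  linear_combination (n + 2 : ℝ) * h6

/-- Kaluza's argument: the sequence `1 / (n + 1)` is log-convex, so the recurrence that inverts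
its generating function has nonnegative coefficients. -/
lemma absGregory_nonneg (n : ℕ) : 0 ≤ absGregory n := by
  induction n using Nat.strong_induction_on with
  | _ n ih =>
    rcases n with _ | n
    · have := sum_absGregory_div 0
      norm_num at this
      rw [this]; norm_num
    · have h1 := sum_absGregory_div (n + 1)
      have h0 := sum_absGregory_div n
      rw [sum_range_succ] at h1
      -- Log-convexity: each ratio `(d + 1) / (d + 2)` with `d ≤ n` is at most `(n + 2) / (n + 3)`.
      have h2 : ∑ i ∈ range (n + 1), absGregory i / ((n + 1 - i : ℕ) + 1 : ℝ) ≤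
          ∑ i ∈ range (n + 1), absGregory i / ((n - i : ℕ) + 1 : ℝ) * ((n + 2) / (n + 3)) := by
        refine Finset.sum_le_sum fun i hi => ?_
        have hi' : i ≤ n := Nat.lt_succ_iff.1 (mem_range.1 hi)
        obtain ⟨d, rfl⟩ := Nat.exists_eq_add_of_le hi'
        have e1 : i + d + 1 - i = d + 1 := by omega
        have e2 : i + d - i = d := by omega
        rw [e1, e2, div_mul_div_comm]
        have hc := ih i (by omega)
        rw [div_le_div_iff₀ (by positivity) (by positivity)]
        push_cast
        nlinarith [mul_nonneg hc (show (0 : ℝ) ≤ i + 1 by positivity)]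
      rw [← Finset.sum_mul, h0] at h2
      have h3 : (1 : ℝ) / (n + 2) * ((n + 2) / (n + 3)) = 1 / (n + 3) := by
        field_simp
      rw [h3] at h2
      simp only [Nat.sub_self, Nat.cast_zero, zero_add, div_one] at h1
      push_cast at h1
      have h4 : (1 : ℝ) / (n + 1 + 2) = 1 / (n + 3) := by ring_nf
      linarith

lemma absGregory_le (n : ℕ) : absGregory n ≤ 1 / (n + 2) := by
  rw [← sum_absGregory_div n, sum_range_succ]
  simp only [Nat.sub_self, Nat.cast_zero, zero_add, div_one]
  have : 0 ≤ ∑ i ∈ range n, absGregory i / ((n - i : ℕ) + 1 : ℝ) :=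
    Finset.sum_nonneg fun i _ => div_nonneg (absGregory_nonneg i) (by positivity)
  linarith

lemma abs_gregory_succ (n : ℕ) : |gregory (n + 1)| = absGregory n := by
  rw [← abs_of_nonneg (absGregory_nonneg n), absGregory, abs_mul, abs_pow]
  simp

lemma absGregory_le_one (n : ℕ) : absGregory n ≤ 1 :=
  (absGregory_le n).trans (by rw [div_le_one (by positivity)]; linarith [n.cast_nonneg (α := ℝ)])

lemma summable_absGregory_mul_pow {z : ℝ} (h0 : 0 ≤ z) (h1 : z < 1) :
    Summable fun n => absGregory n * z ^ n :=
  Summable.of_nonneg_of_le (fun n => mul_nonneg (absGregory_nonneg n) (by positivity))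
    (fun n => mul_le_of_le_one_left (by positivity) (absGregory_le_one n))
    (summable_geometric_of_lt_one h0 h1)

/-- The generating function of `|G_{n+1}|`, from a Cauchy product with the series of the
logarithm. -/
lemma hasSum_absGregory_mul_pow {z : ℝ} (h0 : 0 < z) (h1 : z < 1) :
    HasSum (fun n => absGregory n * z ^ n) (1 / z + 1 / Real.log (1 - z)) := by
  have hL : HasSum (fun n : ℕ => z ^ (n + 1) / ((n : ℝ) + 1)) (-Real.log (1 - z)) :=
    Real.hasSum_pow_div_log_of_abs_lt_one (by rwa [abs_of_pos h0])
  have hlog : Real.log (1 - z) < 0 := Real.log_neg (by linarith) (by linarith)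
  have hA : HasSum (fun n : ℕ => z ^ n / ((n : ℝ) + 1)) (-Real.log (1 - z) / z) := by
    refine (hL.div_const z).congr_fun fun n => ?_
    field_simp
    ring
  have hB : HasSum (fun n : ℕ => z ^ n / ((n : ℝ) + 2)) ((-Real.log (1 - z) - z) / z ^ 2) := by
    have := (hasSum_nat_add_iff' 1).2 hL
    simp only [range_one, sum_singleton, zero_add, pow_one, Nat.cast_zero, div_one] at this
    refine (this.div_const (z ^ 2)).congr_fun fun n => ?_
    push_cast
    have : (n : ℝ) + 2 ≠ 0 := by positivity
    have : (n : ℝ) + 1 + 1 ≠ 0 := by positivity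
    field_simp
    ring
  have hS := summable_absGregory_mul_pow h0.le h1
  have hcauchy := tsum_mul_tsum_eq_tsum_sum_range_of_summable_norm
    (f := fun n => absGregory n * z ^ n)
    (g := fun n : ℕ => z ^ n / ((n : ℝ) + 1)) hS.norm hA.summable.norm
  have hterm : ∀ n : ℕ, ∑ i ∈ range (n + 1), absGregory i * z ^ i *
      (z ^ (n - i) / (((n - i : ℕ) : ℝ) + 1)) = z ^ n / (n + 2) := by
    intro n
    have := congrArg (· * z ^ n) (sum_absGregory_div n)
    simp only [Finset.sum_mul] at this
    rw [div_mul_eq_mul_div, one_mul] at this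
    rw [← this]
    refine Finset.sum_congr rfl fun i hi => ?_
    have hi' : i ≤ n := Nat.lt_succ_iff.1 (mem_range.1 hi)
    have : z ^ n = z ^ i * z ^ (n - i) := by rw [← pow_add]; congr 1; omega
    rw [this]; ring
  simp only [hterm] at hcauchy
  rw [hA.tsum_eq, hB.tsum_eq] at hcauchy
  have : ∑' n, absGregory n * z ^ n = 1 / z + 1 / Real.log (1 - z) := by
    have h2 := hlog.ne
    field_simp at hcauchy ⊢
    linear_combination -hcauchy
  rw [← this]
  exact hS.hasSum

/-- The Beta integral `B(m + 1, n + 1)`. -/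
noncomputable def betaNat (m n : ℕ) : ℝ := ∫ z in (0 : ℝ)..1, z ^ m * (1 - z) ^ n

lemma betaNat_nonneg (m n : ℕ) : 0 ≤ betaNat m n :=
  intervalIntegral.integral_nonneg zero_le_one fun z hz =>
    mul_nonneg (pow_nonneg hz.1 _) (pow_nonneg (by linarith [hz.2]) _)

lemma betaNat_zero_right (m : ℕ) : betaNat m 0 = 1 / (m + 1) := by
  simp [betaNat]

lemma betaNat_sub (m n : ℕ) : betaNat m n - betaNat m (n + 1) = betaNat (m + 1) n := by
  rw [betaNat, betaNat, betaNat, ← intervalIntegral.integral_sub]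
  · congr 1; ext z; ring
  · exact (by fun_prop : Continuous _).intervalIntegrable _ _
  · exact (by fun_prop : Continuous _).intervalIntegrable _ _

/-- Integration by parts. -/
lemma betaNat_parts (m n : ℕ) : betaNat m (n + 1) / (n + 1) = betaNat (m + 1) n / (m + 1) := by
  have h := intervalIntegral.integral_eq_sub_of_hasDerivAt (a := (0 : ℝ)) (b := 1)
    (f := fun z : ℝ => z ^ (m + 1) * (1 - z) ^ (n + 1))
    (f' := fun z : ℝ => (m + 1) * (z ^ m * (1 - z) ^ (n + 1)) -
      (n + 1) * (z ^ (m + 1) * (1 - z) ^ n))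
    (fun z _ => by
      have h1 : HasDerivAt (fun z : ℝ => z ^ (m + 1)) ((m + 1 : ℕ) * z ^ m) z := by
        simpa using hasDerivAt_pow (m + 1) z
      have h2 : HasDerivAt (fun z : ℝ => (1 - z) ^ (n + 1))
          ((n + 1 : ℕ) * (1 - z) ^ n * (-1)) z := by
        simpa using! ((hasDerivAt_id z).const_sub 1).pow (n + 1)
      convert! h1.mul h2 using 1
      push_cast; ring)
    ((by fun_prop : Continuous _).intervalIntegrable _ _)
  rw [intervalIntegral.integral_sub ((by fun_prop : Continuous _).intervalIntegrable _ _)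
    ((by fun_prop : Continuous _).intervalIntegrable _ _), intervalIntegral.integral_const_mul,
    intervalIntegral.integral_const_mul] at h
  simp only [one_pow, sub_self, ne_eq, Nat.add_eq_zero_iff, one_ne_zero, and_false,
    not_false_eq_true, zero_pow, mul_zero, zero_mul] at h
  rw [← betaNat, ← betaNat] at h
  rw [div_eq_div_iff (by positivity) (by positivity)]
  linarith

lemma betaNat_zero_left (n : ℕ) : betaNat 0 n = 1 / (n + 1) := by
  induction n with
  | zero => simp [betaNat]
  | succ n ih =>
    have h1 := betaNat_parts 0 n
    have h2 := betaNat_sub 0 n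
    rw [← h2, ih] at h1
    push_cast
    have : (n : ℝ) + 1 + 1 ≠ 0 := by positivity
    field_simp at h1 ⊢
    norm_num at h1
    linarith

lemma betaNat_succ_le (m n : ℕ) : betaNat (m + 1) n ≤ betaNat m n := by
  have := betaNat_sub m n
  linarith [betaNat_nonneg m (n + 1)]

lemma betaNat_succ_right_le (m n : ℕ) : betaNat m (n + 1) ≤ betaNat m n := by
  have := betaNat_sub m n
  linarith [betaNat_nonneg (m + 1) n]

lemma betaNat_le_left (m n : ℕ) : betaNat m n ≤ 1 / (n + 1) := by
  rw [← betaNat_zero_left]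
  exact antitone_nat_of_succ_le (f := fun m => betaNat m n) (fun m => betaNat_succ_le m n)
    (Nat.zero_le m)

lemma betaNat_le_right (m n : ℕ) : betaNat m n ≤ 1 / (m + 1) := by
  rw [← betaNat_zero_right]
  exact antitone_nat_of_succ_le (betaNat_succ_right_le m) (Nat.zero_le n)

lemma tendsto_betaNat (m : ℕ) : Tendsto (betaNat m) atTop (𝓝 0) :=
  squeeze_zero (betaNat_nonneg m) (betaNat_le_left m) tendsto_one_div_add_atTop_nhds_zero_nat

/-- By `betaNat_parts` and `betaNat_sub` the series telescopes. -/
lemma hasSum_betaNat_div (m : ℕ) :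
    HasSum (fun n => betaNat m (n + 1) / (n + 1)) (1 / (m + 1) ^ 2) := by
  rw [hasSum_iff_tendsto_nat_of_nonneg
    (fun n => div_nonneg (betaNat_nonneg _ _) (by positivity))]
  have h : ∀ N : ℕ, ∑ n ∈ range N, betaNat m (n + 1) / (n + 1)
      = (1 / (m + 1) - betaNat m N) / (m + 1) := by
    intro N
    rw [← betaNat_zero_right, ← Finset.sum_range_sub' (betaNat m), Finset.sum_div]
    refine Finset.sum_congr rfl fun n _ => ?_
    rw [betaNat_parts, betaNat_sub]
  simp only [h]
  have := ((tendsto_betaNat m).const_sub (1 / ((m : ℝ) + 1))).div_const ((m : ℝ) + 1)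
  convert this using 2
  field_simp
  simp

lemma summable_one_div_succ_mul : Summable fun m : ℕ => 1 / ((m : ℝ) + 2) * (1 / (m + 1)) := by
  have h := (summable_nat_add_iff 1).2 (Real.summable_one_div_nat_pow.2 (one_lt_two))
  refine h.of_nonneg_of_le (fun m => by positivity) fun m => ?_
  push_cast
  rw [sq, one_div_mul_one_div]
  apply one_div_le_one_div_of_le (by positivity)
  gcongr; norm_num

lemma absGregory_mul_betaNat_le (m n : ℕ) :
    absGregory m * betaNat m n ≤ 1 / ((m : ℝ) + 2) * (1 / (m + 1)) :=
  mul_le_mul (absGregory_le m) (betaNat_le_right m n) (betaNat_nonneg _ _) (by positivity)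

lemma summable_absGregory_mul_betaNat (n : ℕ) :
    Summable fun m => absGregory m * betaNat m n :=
  Summable.of_nonneg_of_le (fun m => mul_nonneg (absGregory_nonneg m) (betaNat_nonneg _ _))
    (fun m => absGregory_mul_betaNat_le m n) summable_one_div_succ_mul

/-- A Frullani-type integral, from `∫ w^t dt` over `[n, n + 1]` by Fubini. -/
lemma integral_mul_pow_div_log (n : ℕ) :
    ∫ z in (0 : ℝ)..1, z * (1 - z) ^ n / (-Real.log (1 - z)) =
      Real.log ((n + 2) / (n + 1)) := by
  have h1 := intervalIntegral.integral_comp_sub_left (a := (0 : ℝ)) (b := 1)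
    (fun w : ℝ => (1 - w) * w ^ n / (-Real.log w)) 1
  simp only [sub_sub_cancel, sub_self, sub_zero] at h1
  rw [h1]
  have h2 : ∫ w in (0 : ℝ)..1, (1 - w) * w ^ n / (-Real.log w) =
      ∫ w in (0 : ℝ)..1, ∫ t in (n : ℝ)..(n + 1), w ^ t := by
    apply intervalIntegral.integral_congr_ae
    have : ∀ᵐ w : ℝ, w ≠ 1 := by simp [ae_iff, measure_singleton]
    filter_upwards [this] with w hw1 hw
    rw [Set.uIoc_of_le zero_le_one] at hw
    have hlt : w < 1 := lt_of_le_of_ne hw.2 hw1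
    have hlog : Real.log w < 0 := Real.log_neg hw.1 hlt
    have h3 := intervalIntegral.integral_eq_sub_of_hasDerivAt (a := (n : ℝ)) (b := n + 1)
      (f := fun t : ℝ => w ^ t / Real.log w) (f' := fun t : ℝ => w ^ t)
      (fun t _ => by
        have := (Real.hasStrictDerivAt_const_rpow hw.1 t).hasDerivAt.div_const (Real.log w)
        rwa [mul_div_cancel_right₀ _ hlog.ne] at this)
      ((Real.continuous_const_rpow hw.1.ne').intervalIntegrable _ _)
    rw [h3, Real.rpow_add_one hw.1.ne', Real.rpow_natCast]
    field_simp
    ring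
  have h5 : IntegrableOn (Function.uncurry fun w t : ℝ => w ^ t)
      (Set.Ioc (0 : ℝ) 1 ×ˢ Set.Ioc (n : ℝ) (n + 1)) (volume.prod volume) := by
    refine Measure.integrableOn_of_bounded (M := 1) ?_ ?_ ?_
    · rw [Measure.prod_prod]; simp
    · exact (Measurable.pow measurable_fst measurable_snd).aestronglyMeasurable
    · refine (ae_restrict_iff' (measurableSet_Ioc.prod measurableSet_Ioc)).2
        (ae_of_all _ fun x hx => ?_)
      have h6 := hx.1
      have h7 : (0 : ℝ) ≤ x.2 := le_trans (Nat.cast_nonneg n) hx.2.1.le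
      rw [Function.uncurry, Real.norm_of_nonneg (Real.rpow_nonneg h6.1.le _)]
      exact Real.rpow_le_one h6.1.le h6.2 h7
  rw [IntegrableOn, ← Measure.prod_restrict] at h5
  rw [h2]
  simp only [intervalIntegral.integral_of_le (show (n : ℝ) ≤ n + 1 by linarith)]
  rw [intervalIntegral_integral_swap (by rwa [Set.uIoc_of_le zero_le_one]),
    ← intervalIntegral.integral_of_le (show (n : ℝ) ≤ n + 1 by linarith)]
  have h4 : ∫ t in (n : ℝ)..(n + 1), ∫ w in (0 : ℝ)..1, w ^ t =
      ∫ t in (n : ℝ)..(n + 1), (fun x => 1 / x) (t + 1) := by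
    apply intervalIntegral.integral_congr
    intro t ht
    rw [Set.uIcc_of_le (by linarith)] at ht
    have : (0 : ℝ) ≤ t := le_trans (Nat.cast_nonneg n) ht.1
    simp only
    rw [integral_rpow (Or.inl (by linarith)), Real.one_rpow, Real.zero_rpow (by linarith)]
    simp
  rw [h4, intervalIntegral.integral_comp_add_right (fun x => 1 / x),
    integral_one_div_of_pos (by positivity) (by positivity)]
  congr 2; ring

/-! ### The series for `κ₁` and the first Stieltjes constant -/

/-- The generating function of `|G_{n+1}|`, integrated against `z (1 - z)^n`. -/
lemma tsum_absGregory_mul_betaNat_succ (n : ℕ) :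
    ∑' m, absGregory m * betaNat (m + 1) n = 1 / (n + 1) - Real.log ((n + 2) / (n + 1)) := by
  have hb : ∀ m, absGregory m * betaNat (m + 1) n =
      ∫ z in Set.Ioc (0 : ℝ) 1, absGregory m * (z ^ (m + 1) * (1 - z) ^ n) := by
    intro m
    rw [integral_const_mul, betaNat, intervalIntegral.integral_of_le zero_le_one]
  have hint : ∀ m, IntegrableOn (fun z : ℝ => absGregory m * (z ^ (m + 1) * (1 - z) ^ n))
      (Set.Ioc 0 1) := fun m =>
    ((by fun_prop : Continuous fun z : ℝ => absGregory m * (z ^ (m + 1) * (1 - z) ^ n)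
      ).intervalIntegrable 0 1).1
  have hnn : ∀ m, ∀ z ∈ Set.Ioc (0 : ℝ) 1, 0 ≤ absGregory m * (z ^ (m + 1) * (1 - z) ^ n) :=
    fun m z hz => mul_nonneg (absGregory_nonneg m)
      (mul_nonneg (pow_nonneg hz.1.le _) (pow_nonneg (by linarith [hz.2]) _))
  have hnorm : ∀ m, ∫ z in Set.Ioc (0 : ℝ) 1, ‖absGregory m * (z ^ (m + 1) * (1 - z) ^ n)‖ =
      absGregory m * betaNat (m + 1) n := by
    intro m
    rw [hb]
    exact setIntegral_congr_fun measurableSet_Ioc fun z hz => Real.norm_of_nonneg (hnn m z hz)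
  have hsum : Summable fun m => absGregory m * betaNat (m + 1) n :=
    Summable.of_nonneg_of_le (fun m => mul_nonneg (absGregory_nonneg m) (betaNat_nonneg _ _))
      (fun m => mul_le_mul_of_nonneg_left (betaNat_succ_le m n) (absGregory_nonneg m))
      (summable_absGregory_mul_betaNat n)
  have h1 := (hasSum_integral_of_summable_integral_norm hint (by simpa only [hnorm] using hsum)
    ).tsum_eq
  simp only [← hb] at h1
  rw [h1]
  have h2 : ∫ z in Set.Ioc (0 : ℝ) 1, ∑' m, absGregory m * (z ^ (m + 1) * (1 - z) ^ n) =
      ∫ z in Set.Ioc (0 : ℝ) 1, ((1 - z) ^ n - z * (1 - z) ^ n / (-Real.log (1 - z))) := by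
    apply setIntegral_congr_ae measurableSet_Ioc
    have : ∀ᵐ z : ℝ, z ≠ 1 := by simp [ae_iff, measure_singleton]
    filter_upwards [this] with z hz1 hz
    have hlt : z < 1 := lt_of_le_of_ne hz.2 hz1
    have hlog : Real.log (1 - z) < 0 := Real.log_neg (by linarith) (by linarith [hz.1])
    have h3 := ((hasSum_absGregory_mul_pow hz.1 hlt).mul_right (z * (1 - z) ^ n)).tsum_eq
    have h4 : ∀ m, absGregory m * (z ^ (m + 1) * (1 - z) ^ n) =
        absGregory m * z ^ m * (z * (1 - z) ^ n) := fun m => by ring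
    simp only [h4, h3]
    have := hz.1.ne'
    have := hlog.ne
    field_simp
    ring
  have h5 : IntegrableOn (fun z : ℝ => z * (1 - z) ^ n / (-Real.log (1 - z))) (Set.Ioc 0 1) := by
    refine Measure.integrableOn_of_bounded (M := 1) (by simp) (by
      exact (Measurable.aestronglyMeasurable (by fun_prop))) ?_
    refine (ae_restrict_iff' measurableSet_Ioc).2 (ae_of_all _ fun z hz => ?_)
    rcases eq_or_lt_of_le hz.2 with rfl | hlt
    · simp
    have hlog : z ≤ -Real.log (1 - z) := by
      linarith [Real.log_le_sub_one_of_pos (show 0 < 1 - z by linarith)]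
    have hp : (1 - z) ^ n ≤ 1 := pow_le_one₀ (by linarith) (by linarith [hz.1])
    have hp0 : 0 ≤ (1 - z) ^ n := pow_nonneg (by linarith) _
    rw [Real.norm_of_nonneg (div_nonneg (mul_nonneg hz.1.le hp0) (hz.1.le.trans hlog)),
      div_le_one (hz.1.trans_le hlog)]
    nlinarith [hz.1]
  rw [h2, integral_sub (((by fun_prop : Continuous fun z : ℝ => (1 - z) ^ n
      ).intervalIntegrable 0 1).1) h5, ← intervalIntegral.integral_of_le zero_le_one,
    ← intervalIntegral.integral_of_le zero_le_one, integral_mul_pow_div_log]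
  have := betaNat_zero_left n
  simp only [betaNat, pow_zero, one_mul] at this
  rw [this]

/-- Both sides have the same differences in `n` and tend to `0`. -/
lemma tsum_absGregory_mul_betaNat (n : ℕ) :
    ∑' m, absGregory m * betaNat m n =
      Real.eulerMascheroniConstant + Real.log (n + 1) - harmonic n := by
  set E : ℕ → ℝ := fun n => ∑' m, absGregory m * betaNat m n -
    (Real.eulerMascheroniConstant + Real.log (n + 1) - harmonic n) with hE
  have hstep : ∀ n, E (n + 1) = E n := by
    intro n
    have h1 : ∑' m, absGregory m * betaNat m n - ∑' m, absGregory m * betaNat m (n + 1) =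
        1 / (n + 1) - Real.log ((n + 2) / (n + 1)) := by
      rw [← tsum_absGregory_mul_betaNat_succ, ← (summable_absGregory_mul_betaNat n).tsum_sub
        (summable_absGregory_mul_betaNat (n + 1))]
      exact tsum_congr fun m => by rw [← mul_sub, betaNat_sub]
    rw [Real.log_div (by positivity) (by positivity)] at h1
    simp only [hE, harmonic_succ]
    push_cast
    rw [show (n : ℝ) + 1 + 1 = n + 2 by ring]
    rw [one_div] at h1
    linarith
  have hconst : ∀ k, E k = E 0 := fun k => by
    induction k with
    | zero => rfl
    | succ k ih => rw [hstep, ih]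
  have hlim : Tendsto E atTop (𝓝 0) := by
    have h1 : Tendsto (fun n => ∑' m, absGregory m * betaNat m n) atTop (𝓝 (∑' _ : ℕ, 0)) := by
      refine tendsto_tsum_of_dominated_convergence summable_one_div_succ_mul (fun m => ?_)
        (Eventually.of_forall fun n m => ?_)
      · simpa using (tendsto_betaNat m).const_mul (absGregory m)
      · rw [Real.norm_of_nonneg (mul_nonneg (absGregory_nonneg m) (betaNat_nonneg _ _))]
        exact absGregory_mul_betaNat_le m n
    have h2 := (Real.tendsto_harmonic_sub_log_add_one.const_sub Real.eulerMascheroniConstant)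
    rw [sub_self] at h2
    rw [tsum_zero] at h1
    have h3 := h1.sub h2
    rw [sub_zero] at h3
    refine h3.congr fun n => ?_
    simp only [hE]
    ring
  have h0 : E 0 = 0 := tendsto_nhds_unique
    (tendsto_const_nhds.congr fun n => (hconst n).symm) hlim
  have := hconst n
  rw [h0] at this
  simp only [hE] at this
  linarith

lemma summable_gregory_div_sq :
    Summable (fun n : ℕ => |gregory (n + 1)| / ((n : ℝ) + 1) ^ 2) := by
  have h := (summable_nat_add_iff 1).2 (Real.summable_one_div_nat_pow.2 (one_lt_two))
  refine h.of_nonneg_of_le (fun m => by positivity) fun m => ?_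
  rw [abs_gregory_succ]
  push_cast
  gcongr
  exact absGregory_le_one m

/-- `κ₁ = ∑_{n ≥ 1} (γ + ln (n + 1) - H_n) / n`, by exchanging the two summations in
`∑_m ∑_n |G_m| B(m, n + 1) / n`. -/
lemma hasSum_kappaOne :
    HasSum (fun n : ℕ => (Real.eulerMascheroniConstant + Real.log (n + 2) - harmonic (n + 1)) /
      ((n : ℝ) + 1)) kappaOne := by
  set f : ℕ × ℕ → ℝ := fun p => absGregory p.1 * (betaNat p.1 (p.2 + 1) / (p.2 + 1)) with hf
  have hf0 : 0 ≤ f := fun p =>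
    mul_nonneg (absGregory_nonneg _) (div_nonneg (betaNat_nonneg _ _) (by positivity))
  have hrow : ∀ m, HasSum (fun n => f (m, n)) (|gregory (m + 1)| / ((m : ℝ) + 1) ^ 2) := by
    intro m
    have := (hasSum_betaNat_div m).mul_left (absGregory m)
    rw [abs_gregory_succ, ← mul_one_div]
    exact this
  have hs : Summable f := by
    refine (summable_prod_of_nonneg hf0).2 ⟨fun m => (hrow m).summable, ?_⟩
    simpa only [(hrow _).tsum_eq] using summable_gregory_div_sq
  have hcol : ∀ n : ℕ, ∑' m, f (m, n) =
      (Real.eulerMascheroniConstant + Real.log (n + 2) - harmonic (n + 1)) / ((n : ℝ) + 1) := by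
    intro n
    have := tsum_absGregory_mul_betaNat (n + 1)
    push_cast at this
    rw [show (n : ℝ) + 1 + 1 = n + 2 by ring] at this
    rw [← this, ← tsum_div_const]
    exact tsum_congr fun m => by simp only [hf]; ring
  have h1 : ∑' m, ∑' n, f (m, n) = ∑' n, ∑' m, f (m, n) :=
    (Summable.tsum_comm (f := fun m n => f (m, n)) hs).symm
  have h2 : Summable fun n => ∑' m, f (m, n) := by
    have := hs.prod_symm.prod
    exact this
  have h3 := h2.hasSum
  rw [← h1] at h3
  simp only [hcol, (hrow _).tsum_eq] at h3
  exact h3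

lemma sum_harmonic_div (N : ℕ) :
    ∑ n ∈ range N, (harmonic (n + 1) : ℝ) / ((n : ℝ) + 1) =
      ((harmonic N : ℝ) ^ 2 + ∑ n ∈ range N, 1 / ((n : ℝ) + 1) ^ 2) / 2 := by
  induction N with
  | zero => simp
  | succ N ih =>
    rw [sum_range_succ, ih, sum_range_succ, harmonic_succ]
    push_cast
    have : (N : ℝ) + 1 ≠ 0 := by positivity
    field_simp
    ring

lemma harmonic_eq_sum_range (N : ℕ) : (harmonic N : ℝ) = ∑ n ∈ range N, 1 / ((n : ℝ) + 1) := by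
  simp [harmonic]

lemma hasSum_one_div_succ_sq :
    HasSum (fun n : ℕ => 1 / ((n : ℝ) + 1) ^ 2) (Real.pi ^ 2 / 6) := by
  have := (hasSum_nat_add_iff' 1).2 hasSum_zeta_two
  simpa using this

/-- If `S = ∑_{n ≥ 1} ln (1 + 1/n) / n`, then the sequence defining `γ₁` converges, and its limit
is expressed by `κ₁` and `S`. -/
lemma tendsto_stieltjesSeq_one {S : ℝ}
    (hS : HasSum (fun n : ℕ => Real.log (1 + 1 / ((n : ℝ) + 1)) / ((n : ℝ) + 1)) S) :
    Tendsto (stieltjesSeq 1) atTop (𝓝 (kappaOne - S - Real.eulerMascheroniConstant ^ 2 / 2 +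
      Real.pi ^ 2 / 12)) := by
  set γ := Real.eulerMascheroniConstant
  have hid : ∀ N : ℕ, stieltjesSeq 1 N =
      ∑ n ∈ range N, (γ + Real.log (n + 2) - harmonic (n + 1)) / ((n : ℝ) + 1) -
      ∑ n ∈ range N, Real.log (1 + 1 / ((n : ℝ) + 1)) / ((n : ℝ) + 1) +
      (∑ n ∈ range N, 1 / ((n : ℝ) + 1) ^ 2) / 2 +
      ((harmonic N - Real.log N - γ) * (harmonic N - Real.log N - γ) / 2
        + (harmonic N - Real.log N - γ) * Real.log N - γ ^ 2 / 2) := by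
    intro N
    have h1 : ∑ n ∈ range N, (γ + Real.log (n + 2) - harmonic (n + 1)) / ((n : ℝ) + 1) -
        ∑ n ∈ range N, Real.log (1 + 1 / ((n : ℝ) + 1)) / ((n : ℝ) + 1) =
        γ * harmonic N + ∑ n ∈ range N, Real.log (n + 1) / ((n : ℝ) + 1) -
        ∑ n ∈ range N, (harmonic (n + 1) : ℝ) / ((n : ℝ) + 1) := by
      rw [harmonic_eq_sum_range, Finset.mul_sum, ← sum_add_distrib, ← sum_sub_distrib,
        ← sum_sub_distrib]
      refine sum_congr rfl fun n _ => ?_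
      have : (1 : ℝ) + 1 / (n + 1) = (n + 2) / (n + 1) := by field_simp; ring
      rw [this, Real.log_div (by positivity) (by positivity)]
      ring
    have h2 : ∑ i ∈ Icc 1 N, Real.log i ^ 1 / i =
        ∑ n ∈ range N, Real.log (n + 1) / ((n : ℝ) + 1) := by
      rw [range_eq_Ico, ← Finset.Ico_add_one_right_eq_Icc]
      have := sum_Ico_add' (fun i : ℕ => Real.log i ^ 1 / i) 0 N 1
      rw [zero_add] at this
      rw [← this]
      exact sum_congr rfl fun n _ => by push_cast; rw [pow_one]
    rw [h1, sum_harmonic_div, stieltjesSeq, h2]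
    push_cast
    ring
  have hd : Tendsto (fun N : ℕ => (harmonic N : ℝ) - Real.log N - γ) atTop (𝓝 0) := by
    simpa [γ] using Real.tendsto_harmonic_sub_log.sub_const γ
  have hlog : Tendsto (fun N : ℕ => Real.log N / N) atTop (𝓝 0) := by
    have := (Real.isLittleO_log_id_atTop.tendsto_div_nhds_zero).comp
      (tendsto_natCast_atTop_atTop (R := ℝ))
    exact this
  -- `0 ≤ H_N - ln N - γ ≤ 1 / N` makes this product negligible.
  have hdl : Tendsto (fun N : ℕ => ((harmonic N : ℝ) - Real.log N - γ) * Real.log N) atTop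
      (𝓝 0) := by
    refine squeeze_zero' ?_ ?_ hlog
    · filter_upwards [eventually_ge_atTop 1] with N hN
      have h1 := Real.eulerMascheroniConstant_lt_eulerMascheroniSeq' N
      rw [Real.eulerMascheroniSeq', if_neg (by omega)] at h1
      have : (1 : ℝ) ≤ N := by exact_mod_cast hN
      exact mul_nonneg (by simp only [γ]; linarith) (Real.log_nonneg this)
    · filter_upwards [eventually_ge_atTop 1] with N hN
      have h1 := Real.eulerMascheroniSeq_lt_eulerMascheroniConstant N
      rw [Real.eulerMascheroniSeq] at h1
      have hN1 : (1 : ℝ) ≤ N := by exact_mod_cast hN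
      have h2 : Real.log (N + 1) - Real.log N ≤ 1 / N := by
        rw [← Real.log_div (by positivity) (by positivity)]
        refine (Real.log_le_sub_one_of_pos (by positivity)).trans_eq ?_
        field_simp
        ring
      rw [div_eq_mul_one_div, mul_comm]
      refine mul_le_mul_of_nonneg_left ?_ (Real.log_nonneg hN1)
      simp only [γ]
      linarith
  have hlim := ((hasSum_kappaOne.tendsto_sum_nat.sub hS.tendsto_sum_nat).add
    (hasSum_one_div_succ_sq.tendsto_sum_nat.div_const 2)).add
    ((((hd.mul hd).div_const 2).add hdl).sub_const (γ ^ 2 / 2))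
  convert hlim.congr fun N => (hid N).symm using 2
  ring

/-! ### The numbers `ν_k` as moments of the digamma function -/

/-- The integral `∫₀¹ u^p / ((n + 1) (n + 1 + u)) du`. -/
noncomputable def moment (p n : ℕ) : ℝ :=
  ∫ u in (0 : ℝ)..1, u ^ p / (((n : ℝ) + 1) * (n + 1 + u))

/-- The real number `∫₀¹ u^(p-1) (Ψ(1 + u) + γ) du`, written as the sum of the moments of the
partial fractions of the digamma function; it is `ν_{p-1}`. -/
noncomputable def nuReal (p : ℕ) : ℝ := ∑' n, moment p n

lemma intervalIntegrable_moment (p n : ℕ) :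
    IntervalIntegrable (fun u : ℝ => u ^ p / (((n : ℝ) + 1) * (n + 1 + u))) volume 0 1 := by
  apply ContinuousOn.intervalIntegrable
  rw [Set.uIcc_of_le zero_le_one]
  refine ContinuousOn.div (by fun_prop) (by fun_prop) fun u hu => ?_
  have := hu.1
  positivity

lemma moment_nonneg (p n : ℕ) : 0 ≤ moment p n :=
  intervalIntegral.integral_nonneg zero_le_one fun u hu => by
    have := hu.1
    positivity

lemma moment_le (p n : ℕ) : moment p n ≤ 1 / ((n : ℝ) + 1) ^ 2 * (1 / (p + 1)) := by
  have h : ∫ u in (0 : ℝ)..1, u ^ p * (1 / ((n : ℝ) + 1) ^ 2) =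
      1 / ((n : ℝ) + 1) ^ 2 * (1 / (p + 1)) := by
    rw [intervalIntegral.integral_mul_const, integral_pow]
    simp [mul_comm]
  rw [← h]
  refine intervalIntegral.integral_mono_on zero_le_one (intervalIntegrable_moment p n)
    ((by fun_prop : Continuous _).intervalIntegrable _ _) fun u hu => ?_
  have := hu.1
  rw [mul_one_div]
  refine div_le_div_of_nonneg_left (by positivity) (by positivity) ?_
  nlinarith [n.cast_nonneg (α := ℝ)]

lemma moment_le_sq (p n : ℕ) : moment p n ≤ 1 / ((n : ℝ) + 1) ^ 2 :=
  (moment_le p n).trans (mul_le_of_le_one_right (by positivity)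
    (by rw [div_le_one (by positivity)]; linarith [p.cast_nonneg (α := ℝ)]))

lemma summable_moment (p : ℕ) : Summable (moment p) :=
  Summable.of_nonneg_of_le (moment_nonneg p) (moment_le_sq p) hasSum_one_div_succ_sq.summable

lemma moment_eq_sub (p n : ℕ) :
    moment p n = 1 / (((n : ℝ) + 1) ^ 2 * (p + 1)) - moment (p + 1) n / (n + 1) := by
  have h1 : ∫ u in (0 : ℝ)..1, u ^ p * (1 / ((n : ℝ) + 1) ^ 2) =
      1 / (((n : ℝ) + 1) ^ 2 * (p + 1)) := by
    rw [intervalIntegral.integral_mul_const, integral_pow]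
    simp [mul_comm]
  rw [← h1, moment, moment, ← intervalIntegral.integral_div, ← intervalIntegral.integral_sub
    ((by fun_prop : Continuous _).intervalIntegrable _ _)
    ((intervalIntegrable_moment (p + 1) n).div_const _)]
  refine intervalIntegral.integral_congr fun u hu => ?_
  rw [Set.uIcc_of_le zero_le_one] at hu
  have := hu.1
  have : (n : ℝ) + 1 + u ≠ 0 := by positivity
  field_simp
  ring

/-- The geometric expansion of `1 / (n + 1 + u)` to `N` terms, integrated over `[0, 1]`. -/
lemma moment_eq_sum (p n N : ℕ) :
    moment p n = ∑ i ∈ range N, (-1) ^ i / ((i : ℝ) + p + 1) * (1 / ((n : ℝ) + 1) ^ (i + 2)) +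
      (-1) ^ N * moment (p + N) n / (n + 1) ^ N := by
  induction N with
  | zero => simp
  | succ N ih =>
    rw [ih, sum_range_succ, add_assoc _ _ ((-1) ^ (N + 1) * moment (p + (N + 1)) n / _),
      add_right_inj, moment_eq_sub (p + N), ← add_assoc p N 1]
    push_cast
    have : (p : ℝ) + N + 1 ≠ 0 := by positivity
    have : (N : ℝ) + p + 1 ≠ 0 := by positivity
    field_simp
    ring

lemma riemannZeta_add_two (i : ℕ) :
    riemannZeta ((i + 2 : ℕ) : ℂ) = ((∑' n : ℕ, 1 / ((n : ℝ) + 1) ^ (i + 2) : ℝ) : ℂ) := by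
  rw [zeta_nat_eq_tsum_of_gt_one (by omega)]
  have h : Summable fun n : ℕ => 1 / (n : ℝ) ^ (i + 2) :=
    Real.summable_one_div_nat_pow.2 (by omega)
  have h2 := h.tsum_eq_zero_add
  simp only [Nat.cast_zero, ne_eq, Nat.add_eq_zero_iff, OfNat.ofNat_ne_zero, and_false,
    not_false_eq_true, zero_pow, div_zero, zero_add, Nat.cast_add, Nat.cast_one] at h2
  rw [← h2]
  push_cast
  rfl

/-- After summation over `n` the remainder in `moment_eq_sum` is at most `π² / (6 (N + 1))`. -/
lemma tendsto_nuPartial (p : ℕ) :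
    Tendsto (nuPartial ((p : ℤ) - 1)) atTop (𝓝 (nuReal p : ℂ)) := by
  rw [← tendsto_add_atTop_iff_nat 1]
  set r : ℕ → ℝ := fun N => ∑' n : ℕ, (-1) ^ N * moment (p + N) n / ((n : ℝ) + 1) ^ N with hr
  have hterm : ∀ N n : ℕ, |(-1) ^ N * moment (p + N) n / ((n : ℝ) + 1) ^ N| ≤
      1 / ((n : ℝ) + 1) ^ 2 * (1 / (N + 1)) := by
    intro N n
    rw [abs_div, abs_mul, abs_pow, abs_neg, abs_one, one_pow, one_mul,
      abs_of_nonneg (moment_nonneg _ _), abs_of_nonneg (by positivity)]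
    refine (div_le_self (moment_nonneg _ _) (one_le_pow₀ (by linarith [n.cast_nonneg (α := ℝ)]))
      ).trans ((moment_le _ _).trans ?_)
    push_cast
    gcongr
    linarith [p.cast_nonneg (α := ℝ)]
  have hsum : ∀ N, Summable fun n : ℕ => (-1) ^ N * moment (p + N) n / ((n : ℝ) + 1) ^ N :=
    fun N => Summable.of_norm_bounded
      (hasSum_one_div_succ_sq.summable.mul_right (1 / ((N : ℝ) + 1)))
      (hterm N)
  have hr0 : Tendsto r atTop (𝓝 0) := by
    refine squeeze_zero_norm (a := fun N : ℕ => Real.pi ^ 2 / 6 * (1 / ((N : ℝ) + 1)))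
      (fun N => ?_) ?_
    · exact tsum_of_norm_bounded (hasSum_one_div_succ_sq.mul_right _) (hterm N)
    · simpa using (tendsto_one_div_add_atTop_nhds_zero_nat (𝕜 := ℝ)).const_mul (Real.pi ^ 2 / 6)
  have heq : ∀ N, nuPartial ((p : ℤ) - 1) (N + 1) = ((nuReal p - r N : ℝ) : ℂ) := by
    intro N
    have h1 : nuReal p - r N = ∑ i ∈ range N, (-1) ^ i / ((i : ℝ) + p + 1) *
        ∑' n : ℕ, (1 / ((n : ℝ) + 1) ^ (i + 2)) := by
      have hi : ∀ i : ℕ, Summable fun n : ℕ => (1 / ((n : ℝ) + 1) ^ (i + 2)) := fun i => by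
        have := (summable_nat_add_iff 1).2 (Real.summable_one_div_nat_pow.2
          (show 1 < i + 2 by omega))
        simpa using this
      rw [nuReal, hr, ← (summable_moment p).tsum_sub (hsum N)]
      simp only [← tsum_mul_left]
      rw [← Summable.tsum_finsetSum fun i _ => (hi i).mul_left _]
      refine tsum_congr fun n => ?_
      rw [moment_eq_sum p n N]
      ring
    rw [h1, nuPartial, ← Finset.Ico_add_one_right_eq_Icc, sum_Ico_eq_sum_range]
    push_cast
    refine sum_congr (by congr 1) fun i _ => ?_
    have h2 := riemannZeta_add_two i
    push_cast at h2
    rw [add_comm 2 (i : ℂ), h2]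
    rw [pow_add]
    have : (i : ℂ) + 2 + (p - 1) = i + p + 1 := by ring
    rw [this]
    ring
  simp only [heq]
  have := hr0.const_sub (nuReal p)
  rw [sub_zero] at this
  exact (Complex.continuous_ofReal.tendsto _).comp this

lemma nu_sub_one (p : ℕ) : nu ((p : ℤ) - 1) = (nuReal p : ℂ) :=
  (tendsto_nuPartial p).limUnder_eq

lemma nu_natCast (k : ℕ) : nu (k : ℤ) = (nuReal (k + 1) : ℂ) := by
  rw [← nu_sub_one]; push_cast; ring_nf

lemma integral_one_div_add_nat (n : ℕ) :
    ∫ u in (0 : ℝ)..1, 1 / ((n : ℝ) + 1 + u) = Real.log (n + 2) - Real.log (n + 1) := by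
  have := intervalIntegral.integral_comp_add_left (a := (0 : ℝ)) (b := 1) (fun x => 1 / x)
    ((n : ℝ) + 1)
  rw [this, integral_one_div_of_pos (by positivity) (by positivity),
    Real.log_div (by positivity) (by positivity)]
  congr 2 <;> ring

lemma intervalIntegrable_pow_div_add (k n : ℕ) :
    IntervalIntegrable (fun u : ℝ => u ^ k / ((n : ℝ) + 1 + u)) volume 0 1 := by
  apply ContinuousOn.intervalIntegrable
  rw [Set.uIcc_of_le zero_le_one]
  refine ContinuousOn.div (by fun_prop) (by fun_prop) fun u hu => ?_
  have := hu.1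
  positivity

lemma moment_succ (k n : ℕ) :
    moment (k + 1) n = 1 / ((n : ℝ) + 1) * (1 / (k + 1)) -
      ∫ u in (0 : ℝ)..1, u ^ k / ((n : ℝ) + 1 + u) := by
  have h1 : ∫ u in (0 : ℝ)..1, u ^ k * (1 / ((n : ℝ) + 1)) =
      1 / ((n : ℝ) + 1) * (1 / (k + 1)) := by
    rw [intervalIntegral.integral_mul_const, integral_pow]
    simp [mul_comm]
  rw [← h1, moment, ← intervalIntegral.integral_sub
    ((by fun_prop : Continuous _).intervalIntegrable _ _) (intervalIntegrable_pow_div_add k n)]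
  refine intervalIntegral.integral_congr fun u hu => ?_
  rw [Set.uIcc_of_le zero_le_one] at hu
  have := hu.1
  have : (n : ℝ) + 1 + u ≠ 0 := by positivity
  field_simp
  ring

lemma moment_zero (n : ℕ) :
    moment 0 n = Real.log (1 + 1 / ((n : ℝ) + 1)) / ((n : ℝ) + 1) := by
  have h : (1 : ℝ) + 1 / (n + 1) = (n + 2) / (n + 1) := by field_simp; ring
  rw [h, Real.log_div (by positivity) (by positivity), ← integral_one_div_add_nat,
    ← intervalIntegral.integral_div, moment]
  congr 1
  ext u
  rw [pow_zero, div_div, mul_comm]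

lemma hasSum_log_div_nuReal_zero :
    HasSum (fun n : ℕ => Real.log (1 + 1 / ((n : ℝ) + 1)) / ((n : ℝ) + 1)) (nuReal 0) :=
  (summable_moment 0).hasSum.congr_fun fun n => (moment_zero n).symm

lemma nuReal_one : nuReal 1 = Real.eulerMascheroniConstant := by
  refine tendsto_nhds_unique (summable_moment 1).hasSum.tendsto_sum_nat
    (Real.tendsto_harmonic_sub_log_add_one.congr fun N => ?_)
  induction N with
  | zero => simp
  | succ N ih =>
    rw [sum_range_succ, ← ih, moment_succ 0 N]
    simp only [pow_zero, integral_one_div_add_nat, harmonic_succ]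
    push_cast
    rw [show (N : ℝ) + 1 + 1 = N + 2 by ring]
    simp
    ring

/-- The derivative of `ln Γ` on the positive half-line. -/
noncomputable def realDigamma (x : ℝ) : ℝ := deriv (Real.log ∘ Real.Gamma) x

lemma differentiableAt_log_Gamma {x : ℝ} (hx : 0 < x) :
    DifferentiableAt ℝ (Real.log ∘ Real.Gamma) x := by
  refine ((Real.differentiableAt_Gamma ?_).log (Real.Gamma_ne_zero ?_)) <;>
  exact fun m ↦ ne_of_gt (by linarith [m.cast_nonneg (α := ℝ)])

lemma digamma_ofReal {x : ℝ} (hx : 0 < x) : Complex.digamma x = (realDigamma x : ℂ) := by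
  have hm : ∀ m : ℕ, x ≠ -m := fun m ↦ ne_of_gt (by linarith [m.cast_nonneg (α := ℝ)])
  have h1 : HasDerivAt Complex.Gamma (deriv Complex.Gamma x) (x : ℂ) :=
    (Complex.differentiableAt_Gamma _ fun m => by exact_mod_cast hm m).hasDerivAt
  have h2 := h1.comp_ofReal
  have h3 := (Real.differentiableAt_Gamma hm).hasDerivAt.ofReal_comp
  have h4 : deriv Complex.Gamma x = ((deriv Real.Gamma x : ℝ) : ℂ) := by
    refine h2.unique ?_
    simpa only [Complex.Gamma_ofReal] using h3
  rw [Complex.digamma_def, logDeriv_apply, h4, Complex.Gamma_ofReal, realDigamma]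
  have h5 := ((Real.differentiableAt_Gamma hm).hasDerivAt.log (Real.Gamma_ne_zero hm)).deriv
  have h6 : (Real.log ∘ Real.Gamma) = fun y => Real.log (Real.Gamma y) := rfl
  rw [h6, h5]
  push_cast
  rfl

lemma realDigamma_add_one {x : ℝ} (hx : 0 < x) : realDigamma (x + 1) = realDigamma x + 1 / x := by
  have h := Complex.digamma_apply_add_one x fun m => by
    have : x ≠ -m := ne_of_gt (by linarith [m.cast_nonneg (α := ℝ)])
    exact_mod_cast this
  rw [digamma_ofReal hx] at h
  have h2 := digamma_ofReal (show 0 < x + 1 by linarith)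
  push_cast at h2
  rw [h2] at h
  rw [one_div]
  exact_mod_cast h

lemma realDigamma_mono {x y : ℝ} (hx : 0 < x) (hxy : x ≤ y) : realDigamma x ≤ realDigamma y :=
  Real.convexOn_log_Gamma.monotoneOn_deriv (fun _ hz => differentiableAt_log_Gamma hz) hx
    (hx.trans_le hxy) hxy

/-- The monotonicity of the digamma function turns its functional equation into its partial
fraction series. -/
lemma hasSum_realDigamma {x : ℝ} (h0 : 0 ≤ x) (h1 : x ≤ 1) :
    HasSum (fun n : ℕ => x / (((n : ℝ) + 1) * (n + 1 + x)))
      (realDigamma (x + 1) + Real.eulerMascheroniConstant) := by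
  have hone : realDigamma 1 = -Real.eulerMascheroniConstant := by
    have h2 := digamma_ofReal one_pos
    rw [Complex.ofReal_one, Complex.digamma_one] at h2
    exact_mod_cast h2.symm
  have hsum : ∀ N : ℕ, ∑ n ∈ range N, x / (((n : ℝ) + 1) * (n + 1 + x)) =
      realDigamma (x + 1) + Real.eulerMascheroniConstant -
        (realDigamma (N + 1 + x) - realDigamma (N + 1)) := by
    intro N
    induction N with
    | zero => simp [hone, add_comm x 1]
    | succ N ih =>
      have h3 := realDigamma_add_one (show (0 : ℝ) < N + 1 + x by positivity)
      have h4 := realDigamma_add_one (show (0 : ℝ) < N + 1 by positivity)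
      rw [sum_range_succ, ih]
      push_cast
      rw [h4, show (N : ℝ) + 1 + 1 + x = N + 1 + x + 1 by ring, h3]
      have : (N : ℝ) + 1 + x ≠ 0 := by positivity
      field_simp
      ring
  rw [hasSum_iff_tendsto_nat_of_nonneg (fun n => by positivity)]
  simp only [hsum]
  have hz : Tendsto (fun N : ℕ => realDigamma (N + 1 + x) - realDigamma (N + 1)) atTop (𝓝 0) := by
    refine squeeze_zero (fun N => ?_) (fun N => ?_) tendsto_one_div_add_atTop_nhds_zero_nat
    · exact sub_nonneg.2 (realDigamma_mono (by positivity) (by linarith))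
    · have h3 := realDigamma_add_one (show (0 : ℝ) < N + 1 by positivity)
      have h4 := realDigamma_mono (show (0 : ℝ) < N + 1 + x by positivity)
        (show (N : ℝ) + 1 + x ≤ N + 1 + 1 by linarith)
      linarith
  simpa using hz.const_sub (realDigamma (x + 1) + Real.eulerMascheroniConstant)

lemma digamma_add_div_eq {x : ℝ} (h0 : 0 < x) (h1 : x ≤ 1) :
    (Complex.digamma ((x : ℂ) + 1) + (Real.eulerMascheroniConstant : ℂ)) / (x : ℂ) =
      ((∑' n : ℕ, 1 / (((n : ℝ) + 1) * (n + 1 + x)) : ℝ) : ℂ) := by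
  have h := (hasSum_realDigamma h0.le h1).div_const x
  have h2 := digamma_ofReal (show 0 < x + 1 by linarith)
  push_cast at h2
  have h3 : ∀ n : ℕ, x / (((n : ℝ) + 1) * (n + 1 + x)) / x = 1 / (((n : ℝ) + 1) * (n + 1 + x)) :=
    fun n => by field_simp
  simp only [h3] at h
  rw [h2, h.tsum_eq]
  push_cast
  rfl

lemma intervalIntegrable_digamma_add_div :
    IntervalIntegrable (fun x : ℝ =>
      (Complex.digamma ((x : ℂ) + 1) + (Real.eulerMascheroniConstant : ℂ)) / (x : ℂ))
      volume 0 1 := by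
  have hc : ContinuousOn (fun x : ℝ => ∑' n : ℕ, 1 / (((n : ℝ) + 1) * (n + 1 + x)))
      (Set.Icc 0 1) := by
    refine continuousOn_tsum (fun n => ?_) hasSum_one_div_succ_sq.summable fun n x hx => ?_
    · refine ContinuousOn.div (by fun_prop) (by fun_prop) fun u hu => ?_
      have := hu.1
      positivity
    · have := hx.1
      rw [Real.norm_of_nonneg (by positivity)]
      refine one_div_le_one_div_of_le (by positivity) ?_
      nlinarith [n.cast_nonneg (α := ℝ)]
  have hi : IntervalIntegrable (fun x : ℝ =>
      ((∑' n : ℕ, 1 / (((n : ℝ) + 1) * (n + 1 + x)) : ℝ) : ℂ)) volume 0 1 := by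
    apply ContinuousOn.intervalIntegrable
    rw [Set.uIcc_of_le zero_le_one]
    exact Complex.continuous_ofReal.comp_continuousOn hc
  refine hi.congr fun x hx => ?_
  rw [Set.uIoc_of_le zero_le_one] at hx
  exact (digamma_add_div_eq hx.1 hx.2).symm

lemma integral_digamma_add_div :
    ∫ x in (0 : ℝ)..1,
      (Complex.digamma ((x : ℂ) + 1) + (Real.eulerMascheroniConstant : ℂ)) / (x : ℂ) =
      (nuReal 0 : ℂ) := by
  have h1 : ∫ x in (0 : ℝ)..1,
      (Complex.digamma ((x : ℂ) + 1) + (Real.eulerMascheroniConstant : ℂ)) / (x : ℂ) =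
      ∫ x in (0 : ℝ)..1, ((∑' n : ℕ, 1 / (((n : ℝ) + 1) * (n + 1 + x)) : ℝ) : ℂ) := by
    rw [intervalIntegral.integral_of_le zero_le_one, intervalIntegral.integral_of_le zero_le_one]
    exact setIntegral_congr_fun measurableSet_Ioc fun x hx => digamma_add_div_eq hx.1 hx.2
  rw [h1, intervalIntegral.integral_ofReal, intervalIntegral.integral_of_le zero_le_one]
  congr 1
  have hm : ∀ n : ℕ, moment 0 n =
      ∫ u in Set.Ioc (0 : ℝ) 1, 1 / (((n : ℝ) + 1) * (n + 1 + u)) := fun n => by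
    rw [moment, intervalIntegral.integral_of_le zero_le_one]
    simp only [pow_zero]
  have h2 := (hasSum_integral_of_summable_integral_norm (μ := volume.restrict (Set.Ioc (0 : ℝ) 1))
    (F := fun (n : ℕ) (u : ℝ) => 1 / (((n : ℝ) + 1) * (n + 1 + u)))
    (fun n => by
      have := (intervalIntegrable_moment 0 n).1
      simp only [pow_zero] at this
      exact this) (by
      refine (summable_moment 0).congr fun n => ?_
      rw [hm]
      refine setIntegral_congr_fun measurableSet_Ioc fun u hu => ?_
      have := hu.1
      exact (Real.norm_of_nonneg (by positivity)).symm)).tsum_eq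
  rw [← h2, nuReal]
  exact tsum_congr fun n => (hm n).symm

lemma stieltjes_one_eq :
    stieltjes 1 = kappaOne - nuReal 0 - Real.eulerMascheroniConstant ^ 2 / 2 +
      Real.pi ^ 2 / 12 :=
  (tendsto_stieltjesSeq_one hasSum_log_div_nuReal_zero).limUnder_eq

/-! ### Analytic continuation of `∑_n ∫₀¹ u^k (n + 1 + u)^(-s) du` -/

/-- The integral `∫₀¹ u^k (n + 1 + u)^(-s) du`. -/
noncomputable def powMoment (k n : ℕ) (s : ℂ) : ℂ :=
  ∫ u in (0 : ℝ)..1, (u : ℂ) ^ k * (((n : ℝ) + 1 + u : ℝ) : ℂ) ^ (-s)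

lemma hasDerivAt_shift_cpow (n : ℕ) (s : ℂ) {u : ℝ} (hu : 0 ≤ u) :
    HasDerivAt (fun u : ℝ => (((n : ℝ) + 1 + u : ℝ) : ℂ) ^ (1 - s))
      ((1 - s) * (((n : ℝ) + 1 + u : ℝ) : ℂ) ^ (-s)) u := by
  have h1 : HasDerivAt (fun u : ℝ => (((n : ℝ) + 1 + u : ℝ) : ℂ)) 1 u := by
    simpa using ((hasDerivAt_id u).const_add ((n : ℝ) + 1)).ofReal_comp
  have h2 : (((n : ℝ) + 1 + u : ℝ) : ℂ) ∈ Complex.slitPlane :=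
    Complex.ofReal_mem_slitPlane.2 (by positivity)
  have h3 := (hasDerivAt_id _).cpow_const (c := 1 - s) h2
  have h4 := h3.scomp u h1
  simp only [id, smul_eq_mul, mul_one, one_mul] at h4
  rw [sub_sub_cancel_left] at h4
  exact h4

lemma continuousOn_shift_cpow (n : ℕ) (s : ℂ) :
    ContinuousOn (fun u : ℝ => (((n : ℝ) + 1 + u : ℝ) : ℂ) ^ s) (Set.Icc 0 1) := by
  refine ContinuousOn.cpow_const (by fun_prop) fun u hu => ?_
  have := hu.1
  exact Complex.ofReal_mem_slitPlane.2 (by positivity)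

lemma intervalIntegrable_powMoment (k n : ℕ) (s : ℂ) :
    IntervalIntegrable (fun u : ℝ => (u : ℂ) ^ k * (((n : ℝ) + 1 + u : ℝ) : ℂ) ^ (-s))
      volume 0 1 := by
  apply ContinuousOn.intervalIntegrable
  rw [Set.uIcc_of_le zero_le_one]
  exact ContinuousOn.mul (by fun_prop) (continuousOn_shift_cpow n _)

lemma mul_powMoment_zero (n : ℕ) (s : ℂ) :
    (1 - s) * powMoment 0 n s = ((n : ℂ) + 2) ^ (1 - s) - ((n : ℂ) + 1) ^ (1 - s) := by
  have h := intervalIntegral.integral_eq_sub_of_hasDerivAt (a := (0 : ℝ)) (b := 1)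
    (f := fun u : ℝ => (((n : ℝ) + 1 + u : ℝ) : ℂ) ^ (1 - s))
    (f' := fun u : ℝ => (1 - s) * ((u : ℂ) ^ 0 * (((n : ℝ) + 1 + u : ℝ) : ℂ) ^ (-s)))
    (fun u hu => by
      rw [Set.uIcc_of_le zero_le_one] at hu
      simpa only [pow_zero, one_mul] using hasDerivAt_shift_cpow n s hu.1)
    ((intervalIntegrable_powMoment 0 n s).const_mul _)
  rw [intervalIntegral.integral_const_mul, ← powMoment] at h
  rw [h]
  push_cast
  rw [add_zero, show (n : ℂ) + 1 + 1 = n + 2 by ring]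

/-- Integration by parts in `u`; it holds also at the zero of `1 - s`. -/
lemma mul_powMoment_succ (k n : ℕ) (s : ℂ) :
    (1 - s) * powMoment (k + 1) n s =
      ((n : ℂ) + 2) ^ (1 - s) - (k + 1) * powMoment k n (s - 1) := by
  have h := intervalIntegral.integral_eq_sub_of_hasDerivAt (a := (0 : ℝ)) (b := 1)
    (f := fun u : ℝ => (u : ℂ) ^ (k + 1) * (((n : ℝ) + 1 + u : ℝ) : ℂ) ^ (1 - s))
    (f' := fun u : ℝ => (k + 1) * ((u : ℂ) ^ k * (((n : ℝ) + 1 + u : ℝ) : ℂ) ^ (-(s - 1))) +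
      (1 - s) * ((u : ℂ) ^ (k + 1) * (((n : ℝ) + 1 + u : ℝ) : ℂ) ^ (-s)))
    (fun u hu => by
      rw [Set.uIcc_of_le zero_le_one] at hu
      have h1 : HasDerivAt (fun u : ℝ => (u : ℂ) ^ (k + 1)) ((k + 1 : ℕ) * (u : ℂ) ^ k) u := by
        simpa using (hasDerivAt_pow (k + 1) (u : ℂ)).comp_ofReal
      convert! h1.mul (hasDerivAt_shift_cpow n s hu.1) using 1
      rw [neg_sub]
      push_cast
      ring)
    (((intervalIntegrable_powMoment k n (s - 1)).const_mul _).add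
      ((intervalIntegrable_powMoment (k + 1) n s).const_mul _))
  rw [intervalIntegral.integral_add ((intervalIntegrable_powMoment k n (s - 1)).const_mul _)
      ((intervalIntegrable_powMoment (k + 1) n s).const_mul _),
    intervalIntegral.integral_const_mul, intervalIntegral.integral_const_mul, ← powMoment,
    ← powMoment] at h
  push_cast at h
  rw [zero_pow (by omega), zero_mul, sub_zero, one_pow, one_mul,
    show (n : ℂ) + 1 + 1 = n + 2 by ring] at h
  linear_combination h

lemma norm_powMoment_le (k n : ℕ) {s : ℂ} (hs : 0 ≤ s.re) :
    ‖powMoment k n s‖ ≤ ((n : ℝ) + 1) ^ (-s.re) := by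
  have h := intervalIntegral.norm_integral_le_of_norm_le_const (a := (0 : ℝ)) (b := 1)
    (f := fun u : ℝ => (u : ℂ) ^ k * (((n : ℝ) + 1 + u : ℝ) : ℂ) ^ (-s))
    (C := ((n : ℝ) + 1) ^ (-s.re)) fun u hu => ?_
  · simpa [powMoment] using h
  rw [Set.uIoc_of_le zero_le_one] at hu
  have hu0 := hu.1
  rw [norm_mul, norm_pow, Complex.norm_real, Real.norm_of_nonneg hu0.le,
    Complex.norm_cpow_eq_rpow_re_of_pos (by positivity), Complex.neg_re]
  refine (mul_le_of_le_one_left (by positivity) (pow_le_one₀ hu0.le hu.2)).trans ?_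
  exact Real.rpow_le_rpow_of_nonpos (by positivity) (by linarith) (by linarith)

/-- The polynomial `(1 - s) (2 - s) ⋯ (k + 1 - s)`. -/
noncomputable def shiftProd (k : ℕ) (s : ℂ) : ℂ := ∏ i ∈ range (k + 1), ((i : ℂ) + 1 - s)

/-- The polynomial `(2 - s) (3 - s) ⋯ (k + 1 - s)`. -/
noncomputable def shiftProdTail (k : ℕ) (s : ℂ) : ℂ := ∏ i ∈ range k, ((i : ℂ) + 2 - s)

lemma shiftProd_eq (k : ℕ) (s : ℂ) : shiftProd k s = (1 - s) * shiftProdTail k s := by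
  rw [shiftProd, prod_range_succ', shiftProdTail, mul_comm]
  push_cast
  rw [zero_add]
  congr 1
  exact prod_congr rfl fun i _ => by ring

lemma shiftProd_succ (k : ℕ) (s : ℂ) : shiftProd (k + 1) s = (1 - s) * shiftProd k (s - 1) := by
  rw [shiftProd_eq]
  congr 1
  exact prod_congr rfl fun i _ => by ring

lemma differentiable_shiftProd (k : ℕ) : Differentiable ℂ (shiftProd k) := by
  unfold shiftProd; fun_prop

lemma differentiable_shiftProdTail (k : ℕ) : Differentiable ℂ (shiftProdTail k) := by
  unfold shiftProdTail; fun_prop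

/-- The factor `shiftProd k s` clears the denominators that arise from repeated integration by
parts, so the product is an explicit combination of exponentials in `s`. -/
lemma differentiable_shiftProd_mul_powMoment (k n : ℕ) :
    Differentiable ℂ fun s => shiftProd k s * powMoment k n s := by
  have hn1 : (n : ℂ) + 1 ≠ 0 := by exact_mod_cast (Nat.succ_ne_zero n)
  have hn2 : (n : ℂ) + 2 ≠ 0 := by exact_mod_cast (Nat.succ_ne_zero (n + 1))
  have hd1 : Differentiable ℂ fun s : ℂ => ((n : ℂ) + 1) ^ (1 - s) :=
    Differentiable.const_cpow (by fun_prop) (Or.inl hn1)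
  have hd2 : Differentiable ℂ fun s : ℂ => ((n : ℂ) + 2) ^ (1 - s) :=
    Differentiable.const_cpow (by fun_prop) (Or.inl hn2)
  induction k with
  | zero =>
    have : (fun s => shiftProd 0 s * powMoment 0 n s) =
        fun s => ((n : ℂ) + 2) ^ (1 - s) - ((n : ℂ) + 1) ^ (1 - s) := by
      ext s
      rw [← mul_powMoment_zero]
      simp [shiftProd]
    rw [this]
    exact hd2.sub hd1
  | succ k ih =>
    have : (fun s => shiftProd (k + 1) s * powMoment (k + 1) n s) =
        fun s => shiftProd k (s - 1) * ((n : ℂ) + 2) ^ (1 - s) -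
          (k + 1) * (shiftProd k (s - 1) * powMoment k n (s - 1)) := by
      ext s
      rw [shiftProd_succ]
      linear_combination shiftProd k (s - 1) * mul_powMoment_succ k n s
    rw [this]
    refine (((differentiable_shiftProd k).comp (by fun_prop : Differentiable ℂ fun s : ℂ => s - 1)
      ).mul hd2).sub (Differentiable.const_mul ?_ _)
    exact ih.comp (by fun_prop : Differentiable ℂ fun s : ℂ => s - 1)

/-- The Dirichlet-type series `∑_n ∫₀¹ u^k (n + 1 + u)^(-s) du`. -/
noncomputable def momentSeries (k : ℕ) (s : ℂ) : ℂ := ∑' n, powMoment k n s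

lemma summable_succ_rpow_neg {σ : ℝ} (h : 1 < σ) : Summable fun n : ℕ => ((n : ℝ) + 1) ^ (-σ) := by
  have := (summable_nat_add_iff 1).2 (Real.summable_nat_rpow.2 (show -σ < -1 by linarith))
  simpa using this

lemma summable_powMoment (k : ℕ) {s : ℂ} (hs : 1 < s.re) : Summable fun n => powMoment k n s :=
  Summable.of_norm_bounded (summable_succ_rpow_neg hs)
    fun n => norm_powMoment_le k n (by linarith)

lemma differentiableOn_shiftProd_mul_momentSeries (k : ℕ) :
    DifferentiableOn ℂ (fun s => shiftProd k s * momentSeries k s) {s | 1 < s.re} := by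
  intro s₀ hs₀
  obtain ⟨σ, h1, h2⟩ := exists_between (show 1 < s₀.re from hs₀)
  set U : Set ℂ := {s | σ < s.re} ∩ Metric.ball s₀ 1
  have hU : IsOpen U := (isOpen_lt continuous_const Complex.continuous_re).inter Metric.isOpen_ball
  obtain ⟨C, hC⟩ := (isCompact_closedBall s₀ 1).exists_bound_of_continuousOn
    (differentiable_shiftProd k).continuous.continuousOn
  have hd : DifferentiableOn ℂ (fun s => ∑' n, shiftProd k s * powMoment k n s) U := by
    refine Complex.differentiableOn_tsum_of_summable_norm
      ((summable_succ_rpow_neg h1).mul_left C)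
      (fun n => (differentiable_shiftProd_mul_powMoment k n).differentiableOn) hU
      fun n s hs => ?_
    have hCs := hC s (Metric.ball_subset_closedBall hs.2)
    have hσ : σ < s.re := hs.1
    rw [norm_mul]
    refine mul_le_mul hCs ((norm_powMoment_le k n (by linarith)).trans ?_) (norm_nonneg _)
      ((norm_nonneg _).trans hCs)
    exact Real.rpow_le_rpow_of_exponent_le (by linarith [n.cast_nonneg (α := ℝ)]) (by linarith)
  simp only [tsum_mul_left] at hd
  exact (hd.differentiableAt (hU.mem_nhds ⟨h2, Metric.mem_ball_self one_pos⟩)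
    ).differentiableWithinAt

/-- The entire continuation of `(1 - s) ⋯ (k + 1 - s) ∑_n ∫₀¹ u^k (n + 1 + u)^(-s) du`, given by
the recurrence that comes from integration by parts. -/
noncomputable def momentCont : ℕ → ℂ → ℂ
  | 0, _ => -1
  | k + 1, s => -(shiftProdTail k (s - 1) * riemannZeta₁ (s - 1)) - shiftProd k (s - 1) -
      (k + 1) * momentCont k (s - 1)

lemma differentiable_momentCont (k : ℕ) : Differentiable ℂ (momentCont k) := by
  induction k with
  | zero => exact differentiable_const _
  | succ k ih =>
    have hs : Differentiable ℂ fun s : ℂ => s - 1 := by fun_prop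
    exact ((((differentiable_shiftProdTail k).comp hs).mul
      (differentiable_riemannZeta₁.comp hs)).neg.sub ((differentiable_shiftProd k).comp hs)).sub
      ((ih.comp hs).const_mul _)

lemma hasSum_succ_cpow {s : ℂ} (hs : 1 < s.re) :
    HasSum (fun n : ℕ => ((n : ℂ) + 1) ^ (-s)) (riemannZeta s) := by
  have h := zeta_eq_tsum_one_div_nat_add_one_cpow hs
  have h2 : Summable fun n : ℕ => ((n : ℂ) + 1) ^ (-s) := by
    refine Summable.of_norm_bounded (summable_succ_rpow_neg hs) fun n => le_of_eq ?_
    have : (n : ℂ) + 1 = (((n : ℝ) + 1 : ℝ) : ℂ) := by push_cast; rfl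
    rw [this, Complex.norm_cpow_eq_rpow_re_of_pos (by positivity), Complex.neg_re]
  have h3 : riemannZeta s = ∑' n : ℕ, ((n : ℂ) + 1) ^ (-s) := by
    rw [h]
    exact tsum_congr fun n => by rw [Complex.cpow_neg, one_div]
  rw [h3]
  exact h2.hasSum

lemma hasSum_add_two_cpow {s : ℂ} (hs : 1 < s.re) :
    HasSum (fun n : ℕ => ((n : ℂ) + 2) ^ (-s)) (riemannZeta s - 1) := by
  have h := (hasSum_nat_add_iff' 1).2 (hasSum_succ_cpow hs)
  simp only [range_one, sum_singleton, Nat.cast_zero, zero_add, Complex.one_cpow] at h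
  refine h.congr_fun fun n => ?_
  push_cast
  rw [show (n : ℂ) + 1 + 1 = n + 2 by ring]

lemma tendsto_succ_cpow_neg {s : ℂ} (hs : 0 < s.re) :
    Tendsto (fun n : ℕ => ((n : ℂ) + 1) ^ (-s)) atTop (𝓝 0) := by
  rw [tendsto_zero_iff_norm_tendsto_zero]
  have h : ∀ n : ℕ, ‖((n : ℂ) + 1) ^ (-s)‖ = (((n + 1 : ℕ) : ℝ)) ^ (-s.re) := fun n => by
    have : (n : ℂ) + 1 = (((n + 1 : ℕ) : ℝ) : ℂ) := by push_cast; rfl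
    rw [this, Complex.norm_cpow_eq_rpow_re_of_pos (by positivity), Complex.neg_re]
  simp only [h]
  exact ((tendsto_rpow_neg_atTop hs).comp tendsto_natCast_atTop_atTop).comp
    (tendsto_add_atTop_nat 1)

/-- Integration by parts lowers `k` and `s` by one, and the identity theorem extends the result
from `Re s > 2` back to `Re s > 1`. -/
lemma shiftProd_mul_momentSeries (k : ℕ) {s : ℂ} (hs : 1 < s.re) :
    shiftProd k s * momentSeries k s = momentCont k s := by
  induction k generalizing s with
  | zero =>
    have h1 : HasSum (fun n => (1 - s) * powMoment 0 n s) ((1 - s) * momentSeries 0 s) :=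
      (summable_powMoment 0 hs).hasSum.mul_left _
    have h2 := h1.tendsto_sum_nat
    have h3 : ∀ N : ℕ, ∑ n ∈ range N, (1 - s) * powMoment 0 n s =
        ((N : ℂ) + 1) ^ (-(s - 1)) - 1 := by
      intro N
      have := Finset.sum_range_sub (fun n : ℕ => ((n : ℂ) + 1) ^ (1 - s)) N
      simp only [Nat.cast_zero, zero_add, Complex.one_cpow] at this
      rw [neg_sub, ← this]
      refine sum_congr rfl fun n _ => ?_
      rw [mul_powMoment_zero]
      push_cast
      rw [show (n : ℂ) + 1 + 1 = n + 2 by ring]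
    simp only [h3] at h2
    have h4 := (tendsto_succ_cpow_neg (s := s - 1) (by simpa using hs)).sub_const 1
    have := tendsto_nhds_unique h2 h4
    simpa [shiftProd, momentCont] using this
  | succ k ih =>
    have hopen : IsOpen {s : ℂ | 1 < s.re} := isOpen_lt continuous_const Complex.continuous_re
    have hconv : Convex ℝ {s : ℂ | 1 < s.re} := convex_halfSpace_re_gt 1
    have hf := (differentiableOn_shiftProd_mul_momentSeries (k + 1)).analyticOnNhd hopen
    have hg := ((differentiable_momentCont (k + 1)).differentiableOn (s := {s : ℂ | 1 < s.re})
      ).analyticOnNhd hopen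
    refine hf.eqOn_of_preconnected_of_eventuallyEq hg hconv.isPreconnected
      (z₀ := 3) (by norm_num) ?_ hs
    have h3 : ∀ᶠ z : ℂ in 𝓝 3, 2 < z.re :=
      (isOpen_lt continuous_const Complex.continuous_re).mem_nhds (by norm_num)
    filter_upwards [h3] with z hz
    have hz1 : 1 < (z - 1).re := by simp; linarith
    have h4 : (1 - z) * momentSeries (k + 1) z =
        riemannZeta (z - 1) - 1 - (k + 1) * momentSeries k (z - 1) := by
      have h5 := (summable_powMoment (k + 1) (s := z) (by linarith)).hasSum.mul_left (1 - z)
      simp only [mul_powMoment_succ] at h5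
      have h6 := (hasSum_add_two_cpow hz1).sub
        ((summable_powMoment k hz1).hasSum.mul_left ((k : ℂ) + 1))
      rw [neg_sub] at h6
      exact h5.unique h6
    have hz2 : z - 1 ≠ 1 := fun h => by rw [h] at hz1; simp at hz1
    have h7 := riemannZeta_eq_inv_sub_mul hz2
    have h8 : z - 1 - 1 ≠ 0 := sub_ne_zero.2 hz2
    have h9 : shiftProd k (z - 1) * riemannZeta (z - 1) =
        -(shiftProdTail k (z - 1) * riemannZeta₁ (z - 1)) := by
      rw [h7, shiftProd_eq]
      field_simp
      ring
    rw [momentCont, ← ih hz1, shiftProd_succ, ← h9]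
    linear_combination shiftProd k (z - 1) * h4

/-! ### The polar part at `s = 1` -/

/-- The recurrence for `momentCont`, solved away from the positive integers. -/
lemma momentCont_eq (k : ℕ) {s : ℂ} (hs : ∀ m : ℕ, s ≠ m + 1) :
    momentCont k s = shiftProd k s * (∑ j ∈ range k, (-1) ^ j * (k.descFactorial j : ℂ) *
      ((riemannZeta (s - 1 - j) - 1) / shiftProd j s) - (-1) ^ k * (k.factorial : ℂ) /
        shiftProd k s) := by
  have hne : ∀ (j : ℕ) (s : ℂ), (∀ m : ℕ, s ≠ m + 1) → shiftProd j s ≠ 0 := fun j s hs =>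
    prod_ne_zero_iff.2 fun i _ => sub_ne_zero.2 (hs i).symm
  induction k generalizing s with
  | zero =>
    have := hne 0 s hs
    simp only [momentCont, range_zero, sum_empty, pow_zero, Nat.factorial_zero, Nat.cast_one]
    field_simp
    ring
  | succ k ih =>
    have hs' : ∀ m : ℕ, s - 1 ≠ m + 1 := fun m h => hs (m + 1) (by
      push_cast; linear_combination h)
    have h1 : s ≠ 1 := by simpa using hs 0
    have h1' : 1 - s ≠ 0 := sub_ne_zero.2 h1.symm
    have h2 : s - 1 ≠ 1 := by simpa using hs' 0
    have h2' : s - 1 - 1 ≠ 0 := sub_ne_zero.2 h2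
    have hz : shiftProdTail k (s - 1) * riemannZeta₁ (s - 1) =
        -(shiftProd k (s - 1) * riemannZeta (s - 1)) := by
      rw [riemannZeta_eq_inv_sub_mul h2, shiftProd_eq]
      field_simp
      ring
    rw [momentCont, hz, ih hs', sum_range_succ', shiftProd_succ]
    have hQ := hne k (s - 1) hs'
    have hsum : ∑ j ∈ range k, (-1) ^ (j + 1) * ((k + 1).descFactorial (j + 1) : ℂ) *
        ((riemannZeta (s - 1 - (j + 1 : ℕ)) - 1) / shiftProd (j + 1) s) =
        -((k : ℂ) + 1) / (1 - s) * ∑ j ∈ range k, (-1) ^ j * (k.descFactorial j : ℂ) *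
          ((riemannZeta (s - 1 - 1 - j) - 1) / shiftProd j (s - 1)) := by
      rw [Finset.mul_sum]
      refine sum_congr rfl fun j _ => ?_
      have hQj := hne j (s - 1) hs'
      rw [shiftProd_succ, Nat.succ_descFactorial_succ]
      push_cast
      rw [show s - 1 - ((j : ℂ) + 1) = s - 1 - 1 - j by ring]
      field_simp
      ring
    rw [hsum]
    have h0 : shiftProd 0 s = 1 - s := by simp [shiftProd]
    rw [h0, Nat.factorial_succ]
    push_cast
    rw [Nat.descFactorial_zero, sub_zero]
    push_cast
    generalize ∑ j ∈ range k, (-1) ^ j * (k.descFactorial j : ℂ) *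
          ((riemannZeta (s - 1 - 1 - j) - 1) / shiftProd j (s - 1)) = S
    field_simp
    ring

lemma shiftProdTail_one (j : ℕ) : shiftProdTail j 1 = (j.factorial : ℂ) := by
  rw [shiftProdTail, ← prod_range_add_one_eq_factorial]
  push_cast
  exact prod_congr rfl fun i _ => by ring

lemma hasDerivAt_inv_shiftProdTail (j : ℕ) :
    HasDerivAt (fun s => (shiftProdTail j s)⁻¹) ((harmonic j : ℂ) / j.factorial) 1 := by
  induction j with
  | zero => simpa [shiftProdTail] using hasDerivAt_const (1 : ℂ) (1 : ℂ)
  | succ j ih =>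
    have hj : (j : ℂ) + 1 ≠ 0 := by exact_mod_cast (Nat.succ_ne_zero j)
    have h1 : HasDerivAt (fun s : ℂ => (j : ℂ) + 2 - s) (-1) 1 := by
      simpa using (hasDerivAt_id (1 : ℂ)).const_sub ((j : ℂ) + 2)
    have hj' : (j : ℂ) + 2 - 1 ≠ 0 := by convert hj using 1; ring
    have h2 := ih.mul (h1.inv hj')
    have h3 : (fun s => (shiftProdTail (j + 1) s)⁻¹) =
        (fun s => (shiftProdTail j s)⁻¹) * (fun s : ℂ => (j : ℂ) + 2 - s)⁻¹ := by
      ext s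
      simp [shiftProdTail, prod_range_succ, mul_comm]
    rw [h3]
    convert! h2 using 1
    have hf : (j.factorial : ℂ) ≠ 0 := by exact_mod_cast j.factorial_ne_zero
    simp only [Pi.inv_apply]
    rw [shiftProdTail_one, show (j : ℂ) + 2 - 1 = j + 1 by ring, harmonic_succ, Nat.factorial_succ]
    push_cast
    field_simp

/-- Both sides are `∫₀¹ (1 - z)^k dz`. -/
lemma sum_alternating_choose_div (k : ℕ) :
    ∑ j ∈ range (k + 1), (-1 : ℝ) ^ j * (k.choose j : ℝ) / (j + 1) = 1 / (k + 1) := by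
  rw [← betaNat_zero_left, betaNat]
  have h : ∀ z : ℝ, z ^ 0 * (1 - z) ^ k =
      ∑ j ∈ range (k + 1), (-1 : ℝ) ^ j * (k.choose j : ℝ) * z ^ j := by
    intro z
    rw [pow_zero, one_mul, sub_eq_neg_add, add_pow]
    refine sum_congr rfl fun j _ => ?_
    rw [neg_pow, one_pow]
    ring
  simp only [h]
  rw [intervalIntegral.integral_finsetSum fun j _ =>
    (by fun_prop : Continuous _).intervalIntegrable _ _]
  refine sum_congr rfl fun j _ => ?_
  rw [intervalIntegral.integral_const_mul, integral_pow]
  simp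
  ring

lemma sum_alternating_choose_harmonic (k : ℕ) :
    ∑ j ∈ range (k + 2), (-1 : ℝ) ^ j * ((k + 1).choose j : ℝ) * harmonic j = -1 / (k + 1) := by
  have h1 : ∑ j ∈ range (k + 2), (-1 : ℝ) ^ j * ((k + 1).choose j : ℝ) * harmonic j =
      ∑ j ∈ range (k + 1), (-1 : ℝ) ^ j * (k.choose j : ℝ) * harmonic j -
      ∑ j ∈ range (k + 1), (-1 : ℝ) ^ j * (k.choose j : ℝ) * harmonic (j + 1) := by
    rw [sum_range_succ']
    simp only [Nat.choose_succ_succ, harmonic_zero, Rat.cast_zero, mul_zero, add_zero]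
    have h2 : ∑ j ∈ range (k + 1), (-1 : ℝ) ^ j * (k.choose j : ℝ) * harmonic j =
        ∑ j ∈ range (k + 1), (-1 : ℝ) ^ (j + 1) * (k.choose (j + 1) : ℝ) * harmonic (j + 1) := by
      rw [sum_range_succ', sum_range_succ _ k]
      simp
    rw [h2, ← sum_sub_distrib]
    refine sum_congr rfl fun j _ => ?_
    push_cast
    ring
  rw [h1, ← sum_sub_distrib, neg_div, ← sum_alternating_choose_div, ← sum_neg_distrib]
  refine sum_congr rfl fun j _ => ?_
  rw [harmonic_succ]
  push_cast
  ring

/-- The analytic function `g` with `ζ(s) / (k + 1) - ∑_n ∫₀¹ u^k (n + 1 + u)^(-s) du =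
(ζ(s) - 1 / (s - 1)) / (k + 1) + g(s) / (s - 1)`. -/
noncomputable def polarPart (k : ℕ) (s : ℂ) : ℂ :=
  1 / ((k : ℂ) + 1) + ∑ j ∈ range k, (-1) ^ j * (k.descFactorial j : ℂ) *
      ((riemannZeta (s - 1 - j) - 1) * (shiftProdTail j s)⁻¹) -
    (-1) ^ k * (k.factorial : ℂ) * (shiftProdTail k s)⁻¹

lemma hasDerivAt_polarPart (k : ℕ) :
    HasDerivAt (polarPart k) (∑ j ∈ range k, (-1) ^ j * (k.choose j : ℂ) *
      (deriv riemannZeta (-(j : ℂ)) + (riemannZeta (-(j : ℂ)) - 1) * harmonic j) -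
        (-1) ^ k * harmonic k) 1 := by
  have hz : ∀ j : ℕ, HasDerivAt (fun s : ℂ => riemannZeta (s - 1 - j) - 1)
      (deriv riemannZeta (-(j : ℂ))) 1 := by
    intro j
    have h1 : HasDerivAt (fun s : ℂ => s - 1 - j) 1 1 :=
      ((hasDerivAt_id (1 : ℂ)).sub_const 1).sub_const (j : ℂ)
    have hj : -(j : ℂ) ≠ 1 := by
      intro h
      have := congrArg Complex.re h
      simp at this
      linarith [j.cast_nonneg (α := ℝ)]
    have h2 : HasDerivAt riemannZeta (deriv riemannZeta (-(j : ℂ))) ((1 : ℂ) - 1 - j) := by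
      rw [show (1 : ℂ) - 1 - j = -j by ring]
      exact (differentiableAt_riemannZeta hj).hasDerivAt
    simpa using (h2.comp (1 : ℂ) h1).sub_const 1
  have hsum := HasDerivAt.fun_sum (u := range k) fun j _ =>
    ((hz j).mul (hasDerivAt_inv_shiftProdTail j)).const_mul ((-1) ^ j * (k.descFactorial j : ℂ))
  have h := (hsum.const_add (1 / ((k : ℂ) + 1))).sub
    ((hasDerivAt_inv_shiftProdTail k).const_mul ((-1) ^ k * (k.factorial : ℂ)))
  convert! h using 1
  have hfac : ∀ j : ℕ, (j.factorial : ℂ) ≠ 0 := fun j => by exact_mod_cast j.factorial_ne_zero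
  congr 1
  · refine sum_congr rfl fun j _ => ?_
    rw [shiftProdTail_one, Nat.descFactorial_eq_factorial_mul_choose,
      show (1 : ℂ) - 1 - j = -j by ring]
    push_cast
    have := hfac j
    field_simp
  · have := hfac k
    field_simp

lemma hasSum_succ_cpow_sub_powMoment (k : ℕ) {s : ℂ} (hs : 1 < s.re) :
    HasSum (fun n : ℕ => ((n : ℂ) + 1) ^ (-s) / (k + 1) - powMoment k n s)
      (riemannZeta s / (k + 1) - momentSeries k s) :=
  ((hasSum_succ_cpow hs).div_const _).sub (summable_powMoment k hs).hasSum

lemma riemannZeta_div_sub_momentSeries (k : ℕ) {s : ℝ} (h1 : 1 < s) (h2 : s < 2) :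
    riemannZeta s / (k + 1) - momentSeries k s =
      riemannZeta₀ s / (k + 1) + polarPart k s / (s - 1) := by
  have hsn : ∀ m : ℕ, (s : ℂ) ≠ m + 1 := by
    intro m h
    have h3 : s = m + 1 := by exact_mod_cast h
    have h4 : (0 : ℝ) < m := by linarith
    have h5 : (1 : ℝ) ≤ m := by exact_mod_cast (Nat.cast_pos.1 h4 : 0 < m)
    linarith
  have hs1 : (s : ℂ) ≠ 1 := by simpa using hsn 0
  have hs1' : (s : ℂ) - 1 ≠ 0 := sub_ne_zero.2 hs1
  have hs1'' : 1 - (s : ℂ) ≠ 0 := sub_ne_zero.2 hs1.symm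
  have hne : ∀ j : ℕ, shiftProd j s ≠ 0 := fun j =>
    prod_ne_zero_iff.2 fun i _ => sub_ne_zero.2 (hsn i).symm
  have hM : momentSeries k s = ∑ j ∈ range k, (-1) ^ j * (k.descFactorial j : ℂ) *
      ((riemannZeta (s - 1 - j) - 1) / shiftProd j s) - (-1) ^ k * (k.factorial : ℂ) /
        shiftProd k s := by
    have := shiftProd_mul_momentSeries k (s := s) (by simpa using h1)
    rw [momentCont_eq k hsn] at this
    exact mul_left_cancel₀ (hne k) this
  have hk : (k : ℂ) + 1 ≠ 0 := by exact_mod_cast (Nat.succ_ne_zero k)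
  have hinv : ∀ j, (shiftProd j s)⁻¹ = -((shiftProdTail j s)⁻¹ / (s - 1)) := by
    intro j
    rw [shiftProd_eq, mul_inv, ← neg_sub (s : ℂ) 1, inv_neg]
    ring
  rw [hM, riemannZeta_eq_inv_sub_add hs1, polarPart]
  simp only [div_eq_mul_inv _ (shiftProd _ _), hinv]
  have : ∑ j ∈ range k, (-1) ^ j * (k.descFactorial j : ℂ) *
      ((riemannZeta (s - 1 - j) - 1) * -((shiftProdTail j s)⁻¹ / (s - 1))) =
      -(∑ j ∈ range k, (-1) ^ j * (k.descFactorial j : ℂ) *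
      ((riemannZeta (s - 1 - j) - 1) * (shiftProdTail j s)⁻¹)) / (s - 1) := by
    rw [neg_div, Finset.sum_div, ← sum_neg_distrib]
    exact sum_congr rfl fun j _ => by ring
  rw [this]
  field_simp
  ring

/-! ### The closed form of `ν_k` -/

lemma rpow_neg_sub_rpow_neg_le {a u s : ℝ} (ha : 1 ≤ a) (hu : 0 ≤ u) (hs : 1 ≤ s) :
    a ^ (-s) - (a + u) ^ (-s) ≤ s * u / a ^ 2 := by
  have ha0 : 0 < a := by linarith
  have h1 : (a + u) ^ (-s) = a ^ (-s) * (1 + u / a) ^ (-s) := by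
    rw [← Real.mul_rpow ha0.le (by positivity)]
    congr 1
    field_simp
  have h2 : 1 - s * (u / a) ≤ (1 + u / a) ^ (-s) := by
    rw [Real.rpow_def_of_pos (by positivity)]
    have h3 := Real.add_one_le_exp (Real.log (1 + u / a) * -s)
    have h4 := Real.log_le_sub_one_of_pos (show 0 < 1 + u / a by positivity)
    nlinarith
  have h5 : a ^ (-s) ≤ a ^ (-1 : ℝ) :=
    Real.rpow_le_rpow_of_exponent_le ha (by linarith)
  rw [Real.rpow_neg_one] at h5
  calc a ^ (-s) - (a + u) ^ (-s) = a ^ (-s) * (1 - (1 + u / a) ^ (-s)) := by rw [h1]; ring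
    _ ≤ a ^ (-s) * (s * (u / a)) :=
      mul_le_mul_of_nonneg_left (by linarith) (Real.rpow_nonneg ha0.le _)
    _ ≤ a⁻¹ * (s * (u / a)) := mul_le_mul_of_nonneg_right h5 (by positivity)
    _ = s * u / a ^ 2 := by field_simp

lemma powMoment_ofReal (k n : ℕ) (s : ℝ) :
    powMoment k n s = ((∫ u in (0 : ℝ)..1, u ^ k * ((n : ℝ) + 1 + u) ^ (-s) : ℝ) : ℂ) := by
  rw [powMoment, ← intervalIntegral.integral_ofReal]
  refine intervalIntegral.integral_congr fun u hu => ?_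
  rw [Set.uIcc_of_le zero_le_one] at hu
  have := hu.1
  push_cast
  rw [Complex.ofReal_cpow (by positivity)]
  push_cast
  rfl

lemma intervalIntegrable_pow_mul_rpow (k n : ℕ) (s : ℝ) :
    IntervalIntegrable (fun u : ℝ => u ^ k * ((n : ℝ) + 1 + u) ^ (-s)) volume 0 1 := by
  apply ContinuousOn.intervalIntegrable
  rw [Set.uIcc_of_le zero_le_one]
  refine ContinuousOn.mul (by fun_prop) (ContinuousOn.rpow_const (by fun_prop) fun u hu => ?_)
  have := hu.1
  exact Or.inl (by positivity)

lemma succ_cpow_sub_powMoment_ofReal (k n : ℕ) (s : ℝ) :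
    ((n : ℂ) + 1) ^ (-(s : ℂ)) / (k + 1) - powMoment k n s =
      ((∫ u in (0 : ℝ)..1, u ^ k * (((n : ℝ) + 1) ^ (-s) - ((n : ℝ) + 1 + u) ^ (-s)) : ℝ) : ℂ) := by
  simp only [mul_sub]
  rw [powMoment_ofReal, intervalIntegral.integral_sub
    ((by fun_prop : Continuous _).intervalIntegrable _ _) (intervalIntegrable_pow_mul_rpow k n s),
    intervalIntegral.integral_mul_const, integral_pow]
  push_cast
  rw [Complex.ofReal_cpow (by positivity)]
  simp
  ring

lemma norm_succ_cpow_sub_powMoment_le (k n : ℕ) {s : ℝ} (h1 : 1 ≤ s) (h2 : s ≤ 2) :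
    ‖((n : ℂ) + 1) ^ (-(s : ℂ)) / (k + 1) - powMoment k n s‖ ≤ 2 * (1 / ((n : ℝ) + 1) ^ 2) := by
  rw [succ_cpow_sub_powMoment_ofReal, Complex.norm_real]
  have h := intervalIntegral.norm_integral_le_of_norm_le_const (a := (0 : ℝ)) (b := 1)
    (f := fun u : ℝ => u ^ k * (((n : ℝ) + 1) ^ (-s) - ((n : ℝ) + 1 + u) ^ (-s)))
    (C := 2 * (1 / ((n : ℝ) + 1) ^ 2)) fun u hu => ?_
  · simpa using h
  rw [Set.uIoc_of_le zero_le_one] at hu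
  have hu0 := hu.1.le
  have h3 := rpow_neg_sub_rpow_neg_le (a := (n : ℝ) + 1) (by linarith [n.cast_nonneg (α := ℝ)])
    hu0 h1
  have h4 : ((n : ℝ) + 1 + u) ^ (-s) ≤ ((n : ℝ) + 1) ^ (-s) :=
    Real.rpow_le_rpow_of_nonpos (by positivity) (by linarith) (by linarith)
  rw [norm_mul, norm_pow, Real.norm_of_nonneg hu0, Real.norm_of_nonneg (by linarith)]
  refine (mul_le_of_le_one_left (by linarith) (pow_le_one₀ hu0 hu.2)).trans (h3.trans ?_)
  rw [mul_one_div]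
  gcongr
  nlinarith [hu.2]

lemma tendsto_powMoment (k n : ℕ) :
    Tendsto (fun s : ℝ => powMoment k n s) (𝓝[>] 1)
      (𝓝 ((∫ u in (0 : ℝ)..1, u ^ k / ((n : ℝ) + 1 + u) : ℝ) : ℂ)) := by
  have h1 : ∫ u in (0 : ℝ)..1, u ^ k / ((n : ℝ) + 1 + u) =
      ∫ u in (0 : ℝ)..1, u ^ k * ((n : ℝ) + 1 + u) ^ (-(1 : ℝ)) :=
    intervalIntegral.integral_congr fun u hu => by
      simp only [Real.rpow_neg_one, div_eq_mul_inv]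
  simp only [powMoment_ofReal, h1]
  refine (Complex.continuous_ofReal.tendsto _).comp ?_
  refine intervalIntegral.tendsto_integral_filter_of_dominated_convergence (fun _ => 1) ?_ ?_
    (by simp) ?_
  · refine Eventually.of_forall fun s => ?_
    rw [Set.uIoc_of_le zero_le_one]
    exact (intervalIntegrable_pow_mul_rpow k n s).1.aestronglyMeasurable
  · filter_upwards [self_mem_nhdsWithin] with s hs
    refine ae_of_all _ fun u hu => ?_
    rw [Set.uIoc_of_le zero_le_one] at hu
    have hu0 := hu.1.le
    have hs1 : 1 < s := hs
    rw [norm_mul, norm_pow, Real.norm_of_nonneg hu0, Real.norm_of_nonneg (by positivity)]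
    exact mul_le_one₀ (pow_le_one₀ hu0 hu.2) (by positivity)
      (Real.rpow_le_one_of_one_le_of_nonpos (by linarith [n.cast_nonneg (α := ℝ)]) (by linarith))
  · refine ae_of_all _ fun u hu => ?_
    rw [Set.uIoc_of_le zero_le_one] at hu
    have hu0 := hu.1
    have hc : Continuous fun s : ℝ => u ^ k * ((n : ℝ) + 1 + u) ^ (-s) :=
      continuous_const.mul (Continuous.rpow continuous_const continuous_neg
        fun s => Or.inl (by positivity))
    exact (hc.tendsto 1).mono_left nhdsWithin_le_nhds

lemma tendsto_riemannZeta_div_sub_momentSeries (k : ℕ) :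
    Tendsto (fun s : ℝ => riemannZeta s / (k + 1) - momentSeries k s) (𝓝[>] 1)
      (𝓝 (nuReal (k + 1) : ℂ)) := by
  have hIoo : Set.Ioo (1 : ℝ) 2 ∈ 𝓝[>] (1 : ℝ) := Ioo_mem_nhdsGT (by norm_num)
  have h := tendsto_tsum_of_dominated_convergence (𝓕 := 𝓝[>] (1 : ℝ))
    (f := fun (s : ℝ) (n : ℕ) => ((n : ℂ) + 1) ^ (-(s : ℂ)) / (k + 1) - powMoment k n s)
    (g := fun n => (moment (k + 1) n : ℂ)) (hasSum_one_div_succ_sq.summable.mul_left 2)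
    (fun n => ?_) ?_
  · rw [nuReal, Complex.ofReal_tsum]
    refine h.congr' ?_
    filter_upwards [hIoo] with s hs
    exact (hasSum_succ_cpow_sub_powMoment k (s := s) (by simpa using hs.1)).tsum_eq
  · have hn : (n : ℂ) + 1 ≠ 0 := by exact_mod_cast (Nat.succ_ne_zero n)
    have hc : Continuous fun s : ℝ => ((n : ℂ) + 1) ^ (-(s : ℂ)) / ((k : ℂ) + 1) :=
      (Continuous.const_cpow (by fun_prop) (Or.inl hn)).div_const _
    have h2 := ((hc.tendsto 1).mono_left nhdsWithin_le_nhds).sub (tendsto_powMoment k n)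
    convert h2 using 2
    rw [moment_succ]
    push_cast
    rw [Complex.cpow_neg_one]
    ring
  · filter_upwards [hIoo] with s hs n
    exact norm_succ_cpow_sub_powMoment_le k n hs.1.le hs.2.le

/-- The left-hand side of `riemannZeta_div_sub_momentSeries` stays bounded as `s → 1`, so the
polar part vanishes at `1`, and its derivative there gives the value of the limit. -/
lemma nuReal_succ_eq_deriv_polarPart (k : ℕ) {d : ℂ} (hd : HasDerivAt (polarPart k) d 1) :
    (nuReal (k + 1) : ℂ) = Real.eulerMascheroniConstant / (k + 1) + d := by
  have hIoo : Set.Ioo (1 : ℝ) 2 ∈ 𝓝[>] (1 : ℝ) := Ioo_mem_nhdsGT (by norm_num)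
  have hz : Tendsto (fun s : ℝ => riemannZeta₀ s / ((k : ℂ) + 1)) (𝓝[>] 1)
      (𝓝 (Real.eulerMascheroniConstant / ((k : ℂ) + 1))) := by
    have hc : Continuous fun s : ℝ => riemannZeta₀ s / ((k : ℂ) + 1) :=
      (differentiable_riemannZeta₀.continuous.comp Complex.continuous_ofReal).div_const _
    have := (hc.tendsto 1).mono_left (nhdsWithin_le_nhds (s := Set.Ioi 1))
    simpa using this
  have h1 : Tendsto (fun s : ℝ => polarPart k s / ((s : ℂ) - 1)) (𝓝[>] (1 : ℝ))
      (𝓝 ((nuReal (k + 1) : ℂ) - Real.eulerMascheroniConstant / ((k : ℂ) + 1))) := by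
    refine ((tendsto_riemannZeta_div_sub_momentSeries k).sub hz).congr' ?_
    filter_upwards [hIoo] with s hs
    rw [riemannZeta_div_sub_momentSeries k hs.1 hs.2]
    ring
  have hd' : HasDerivAt (fun s : ℝ => polarPart k s) d 1 :=
    HasDerivAt.comp_ofReal (by simpa using hd)
  have hid : Tendsto (fun s : ℝ => (s : ℂ) - 1) (𝓝[>] 1) (𝓝 0) := by
    have hc : Continuous fun s : ℝ => (s : ℂ) - 1 := by fun_prop
    simpa using (hc.tendsto 1).mono_left (nhdsWithin_le_nhds (s := Set.Ioi 1))
  have hp0 : polarPart k 1 = 0 := by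
    have h2 := h1.mul hid
    rw [mul_zero] at h2
    have h3 := hd'.continuousAt.tendsto.mono_left (nhdsWithin_le_nhds (s := Set.Ioi 1))
    rw [Complex.ofReal_one] at h3
    refine tendsto_nhds_unique (h3.congr' ?_) h2
    filter_upwards [self_mem_nhdsWithin] with s hs
    have : (s : ℂ) - 1 ≠ 0 := sub_ne_zero.2 (by exact_mod_cast (ne_of_gt hs))
    rw [div_mul_cancel₀ _ this]
  have h4 : Tendsto (slope (fun s : ℝ => polarPart k s) 1) (𝓝[>] (1 : ℝ)) (𝓝 d) :=
    (hasDerivAt_iff_tendsto_slope.1 hd').mono_left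
      (nhdsWithin_mono 1 fun s (hs : 1 < s) => ne_of_gt hs)
  have h5 := tendsto_nhds_unique (h4.congr fun s => ?_) h1
  · rw [h5]; ring
  · rw [slope_def_module, Complex.ofReal_one, hp0, sub_zero, Complex.real_smul]
    push_cast
    ring

lemma nuReal_closed_form (k : ℕ) (hk : 1 ≤ k) :
    (nuReal (k + 1) : ℂ) = (Real.eulerMascheroniConstant : ℂ) / ((k : ℂ) + 1) + 1 / (k : ℂ) +
      ∑ m ∈ range k, (-1 : ℂ) ^ m * (k.choose m : ℂ) *
        (deriv riemannZeta (-(m : ℂ)) + ((harmonic m : ℚ) : ℂ) * riemannZeta (-(m : ℂ))) := by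
  rw [nuReal_succ_eq_deriv_polarPart k (hasDerivAt_polarPart k), add_assoc]
  congr 1
  obtain ⟨k, rfl⟩ := Nat.exists_eq_add_of_le' hk
  have h := congrArg (fun x : ℝ => (x : ℂ)) (sum_alternating_choose_harmonic k)
  rw [sum_range_succ] at h
  push_cast at h
  simp only [Nat.choose_self, Nat.cast_one, mul_one] at h
  push_cast
  have h2 : ∑ j ∈ range (k + 1), (-1 : ℂ) ^ j * ((k + 1).choose j : ℂ) *
      (deriv riemannZeta (-(j : ℂ)) + (riemannZeta (-(j : ℂ)) - 1) * (harmonic j : ℂ)) =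
      ∑ m ∈ range (k + 1), (-1 : ℂ) ^ m * ((k + 1).choose m : ℂ) *
        (deriv riemannZeta (-(m : ℂ)) + ((harmonic m : ℚ) : ℂ) * riemannZeta (-(m : ℂ))) -
      ∑ j ∈ range (k + 1), (-1 : ℂ) ^ j * ((k + 1).choose j : ℂ) * (harmonic j : ℂ) := by
    rw [← sum_sub_distrib]
    exact sum_congr rfl fun j _ => by ring
  rw [h2]
  linear_combination -h

/-! ### The weight `1 / cosh (π x)` on the critical line -/

/-- The point `1/2 + i x` of the critical line. -/
noncomputable def critPt (x : ℝ) : ℂ := 1 / 2 + Complex.I * x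

@[simp] lemma critPt_re (x : ℝ) : (critPt x).re = 1 / 2 := by simp [critPt]

lemma continuous_critPt : Continuous critPt := by unfold critPt; fun_prop

/-- The weight `1 / cosh (π x)`. -/
noncomputable def sechWeight (x : ℝ) : ℝ := (Real.cosh (Real.pi * x))⁻¹

lemma sechWeight_pos (x : ℝ) : 0 < sechWeight x := inv_pos.2 (Real.cosh_pos _)

lemma sechWeight_neg (x : ℝ) : sechWeight (-x) = sechWeight x := by
  simp [sechWeight, Real.cosh_neg]

lemma continuous_sechWeight : Continuous sechWeight := by
  unfold sechWeight
  exact (Real.continuous_cosh.comp (by fun_prop)).inv₀ fun x => (Real.cosh_pos _).ne'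

lemma inv_cosh_eq_sechWeight (x : ℝ) :
    (Complex.cosh (Real.pi * x))⁻¹ = (sechWeight x : ℂ) := by
  rw [sechWeight]; push_cast; rfl

lemma integrable_sechWeight : Integrable sechWeight := by
  have h1 : Integrable fun x : ℝ => 4 * (1 + (Real.pi * x) ^ 2)⁻¹ :=
    (integrable_inv_one_add_sq.comp_mul_left' Real.pi_ne_zero).const_mul 4
  refine h1.mono' continuous_sechWeight.aestronglyMeasurable (ae_of_all _ fun x => ?_)
  rw [Real.norm_of_nonneg (sechWeight_pos x).le, sechWeight, ← div_eq_mul_inv,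
    inv_eq_one_div, div_le_div_iff₀ (Real.cosh_pos _) (by positivity), one_mul,
    ← Real.cosh_abs, ← sq_abs, Real.cosh_eq]
  have h2 := Real.quadratic_le_exp_of_nonneg (abs_nonneg (Real.pi * x))
  have h3 := Real.exp_pos (-|Real.pi * x|)
  nlinarith [abs_nonneg (Real.pi * x)]

/-- The function `1 / cosh (π x)` is its own Fourier transform: the substitution `t = e^(2πv) /
(1 + e^(2πv))` turns the integral into the Beta integral `B(1/2 + i y, 1/2 - i y)`. -/
lemma integral_exp_mul_sechWeight (y : ℝ) :
    ∫ v : ℝ, Complex.exp (2 * Real.pi * Complex.I * v * y) * sechWeight v =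
      (sechWeight y : ℂ) := by
  have hπ := Real.pi_pos
  set s : ℂ := critPt y with hs
  have hsre : s.re = 1 / 2 := critPt_re y
  have hbeta : Complex.betaIntegral s (1 - s) = Real.pi * sechWeight y := by
    rw [Complex.betaIntegral_eq_Gamma_mul_div _ _ (by rw [hsre]; norm_num)
      (by rw [Complex.sub_re, hsre]; norm_num), add_sub_cancel, Complex.Gamma_one, div_one,
      Complex.Gamma_mul_Gamma_one_sub, div_eq_mul_inv, ← inv_cosh_eq_sechWeight]
    congr 2
    rw [hs, critPt, ← Complex.cos_mul_I, ← Complex.sin_add_pi_div_two]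
    congr 1
    ring
  have himg : (fun v : ℝ => Real.sigmoid (2 * Real.pi * v)) '' Set.univ = Set.Ioo 0 1 := by
    rw [Set.image_univ, ← Real.range_sigmoid]
    ext z
    constructor
    · rintro ⟨v, rfl⟩; exact ⟨_, rfl⟩
    · rintro ⟨w, rfl⟩
      exact ⟨w / (2 * Real.pi), by simp only; congr 1; field_simp⟩
  have hsub := integral_image_eq_integral_abs_deriv_smul (s := Set.univ)
    (f := fun v : ℝ => Real.sigmoid (2 * Real.pi * v))
    (f' := fun v => Real.sigmoid (2 * Real.pi * v) * (1 - Real.sigmoid (2 * Real.pi * v)) *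
      (2 * Real.pi)) MeasurableSet.univ
    (fun v _ => ((Real.hasDerivAt_sigmoid _).comp v
      (by simpa using (hasDerivAt_id v).const_mul (2 * Real.pi))).hasDerivWithinAt)
    (fun a _ b _ hab => by
      have := Real.sigmoid_injective hab
      exact mul_left_cancel₀ (by positivity) this)
    (fun x : ℝ => (x : ℂ) ^ (s - 1) * (1 - (x : ℂ)) ^ (1 - s - 1))
  rw [himg, setIntegral_univ, ← integral_Ioc_eq_integral_Ioo,
    ← intervalIntegral.integral_of_le zero_le_one, ← Complex.betaIntegral, hbeta] at hsub
  have hpt : ∀ v : ℝ, |Real.sigmoid (2 * Real.pi * v) * (1 - Real.sigmoid (2 * Real.pi * v)) *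
      (2 * Real.pi)| • ((Real.sigmoid (2 * Real.pi * v) : ℂ) ^ (s - 1) *
        (1 - (Real.sigmoid (2 * Real.pi * v) : ℂ)) ^ (1 - s - 1)) =
      Real.pi * (Complex.exp (2 * Real.pi * Complex.I * v * y) * sechWeight v) := by
    intro v
    set c := Real.cosh (Real.pi * v) with hc
    have hc0 : 0 < c := Real.cosh_pos _
    have h2c : 2 * c = Real.exp (Real.pi * v) + Real.exp (-(Real.pi * v)) := by
      rw [hc, Real.cosh_eq]; ring
    set p := Real.sigmoid (2 * Real.pi * v) with hp
    have hp1 : p = Real.exp (Real.pi * v) / (2 * c) := by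
      rw [hp, Real.sigmoid_def, h2c, inv_eq_one_div, div_eq_div_iff (by positivity) (by positivity),
        one_mul, mul_add, mul_one, ← Real.exp_add]
      ring_nf
    have hp2 : 1 - p = Real.exp (-(Real.pi * v)) / (2 * c) := by
      rw [hp1, eq_div_iff (by positivity), sub_mul, div_mul_cancel₀ _ (by positivity), h2c]
      ring
    have hp0 : 0 < p := Real.sigmoid_pos _
    have hp0' : 0 < 1 - p := by rw [hp2]; positivity
    have hl1 : Real.log p = Real.pi * v - Real.log (2 * c) := by
      rw [hp1, Real.log_div (Real.exp_pos _).ne' (by positivity), Real.log_exp]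
    have hl2 : Real.log (1 - p) = -(Real.pi * v) - Real.log (2 * c) := by
      rw [hp2, Real.log_div (Real.exp_pos _).ne' (by positivity), Real.log_exp]
    have hcast : 1 - (p : ℂ) = ((1 - p : ℝ) : ℂ) := by push_cast; rfl
    rw [hcast, Complex.cpow_def_of_ne_zero (by exact_mod_cast hp0.ne'),
      Complex.cpow_def_of_ne_zero (by exact_mod_cast hp0'.ne'), ← Complex.ofReal_log hp0.le,
      ← Complex.ofReal_log hp0'.le, ← Complex.exp_add, hl1, hl2, abs_of_pos (by positivity)]
    have hexp : ((Real.pi * v - Real.log (2 * c) : ℝ) : ℂ) * (s - 1) +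
        ((-(Real.pi * v) - Real.log (2 * c) : ℝ) : ℂ) * (1 - s - 1) =
        2 * Real.pi * Complex.I * v * y + (Real.log (2 * c) : ℝ) := by
      rw [hs, critPt]
      push_cast
      ring
    rw [hexp, Complex.exp_add, ← Complex.ofReal_exp, Real.exp_log (by positivity),
      Complex.real_smul, hp2, hp1, sechWeight, ← hc]
    have he : Real.exp (Real.pi * v) / (2 * c) * (Real.exp (-(Real.pi * v)) / (2 * c)) =
        1 / (2 * c) ^ 2 := by
      rw [div_mul_div_comm, ← Real.exp_add]
      simp [sq]
    rw [he]
    push_cast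
    have : (c : ℂ) ≠ 0 := by exact_mod_cast hc0.ne'
    field_simp
  simp only [hpt] at hsub
  rw [integral_const_mul] at hsub
  exact (mul_left_cancel₀ (by exact_mod_cast hπ.ne') hsub).symm

lemma integral_cpow_mul_sechWeight {y : ℝ} (hy : 0 < y) :
    ∫ x : ℝ, (y : ℂ) ^ critPt x * sechWeight x = ((2 * y / (1 + y) : ℝ) : ℂ) := by
  have h := integral_exp_mul_sechWeight (Real.log y / (2 * Real.pi))
  have hπ := Real.pi_pos
  have hπ' : (Real.pi : ℂ) ≠ 0 := by exact_mod_cast hπ.ne'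
  have h1 : ∀ x : ℝ, (y : ℂ) ^ critPt x * sechWeight x = ((√y : ℝ) : ℂ) *
      (Complex.exp (2 * Real.pi * Complex.I * x * (Real.log y / (2 * Real.pi) : ℝ)) *
        sechWeight x) := by
    intro x
    have hsq : ((√y : ℝ) : ℂ) = Complex.exp ((Real.log y : ℝ) * (1 / 2)) := by
      rw [Real.sqrt_eq_rpow, Real.rpow_def_of_pos hy]
      push_cast
      rfl
    rw [← mul_assoc, hsq, ← Complex.exp_add, Complex.cpow_def_of_ne_zero (by exact_mod_cast hy.ne'),
      ← Complex.ofReal_log hy.le, critPt]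
    congr 2
    push_cast
    field_simp
  simp only [h1]
  rw [integral_const_mul, h, sechWeight, ← Complex.ofReal_mul]
  congr 1
  have h2 : Real.pi * (Real.log y / (2 * Real.pi)) = Real.log y / 2 := by field_simp
  have h3 : Real.exp (Real.log y / 2) = √y := by
    rw [Real.sqrt_eq_rpow, Real.rpow_def_of_pos hy]; ring_nf
  rw [h2, Real.cosh_eq, Real.exp_neg, h3]
  have h4 : 0 < √y := Real.sqrt_pos.2 hy
  have h5 : √y * √y = y := Real.mul_self_sqrt hy.le
  field_simp
  rw [sq, h5]
  ring

lemma critPt_add_natCast_ne_zero (k : ℕ) (x : ℝ) : critPt x + k ≠ 0 := by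
  intro h
  have := congrArg Complex.re h
  simp at this
  linarith [k.cast_nonneg (α := ℝ)]

lemma integral_cpow_critPt_add (k : ℕ) (x : ℝ) {y : ℝ} (hy : 0 < y) :
    ∫ u in (0 : ℝ)..1, (u : ℂ) ^ ((k : ℂ) - 1) * ((u * y : ℝ) : ℂ) ^ critPt x =
      (y : ℂ) ^ critPt x / (critPt x + k) := by
  have h1 : ∫ u in (0 : ℝ)..1, (u : ℂ) ^ ((k : ℂ) - 1) * ((u * y : ℝ) : ℂ) ^ critPt x =
      ∫ u in (0 : ℝ)..1, (y : ℂ) ^ critPt x * (u : ℂ) ^ (critPt x + k - 1) := by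
    rw [intervalIntegral.integral_of_le zero_le_one, intervalIntegral.integral_of_le zero_le_one]
    refine setIntegral_congr_fun measurableSet_Ioc fun u hu => ?_
    rw [Complex.ofReal_mul, Complex.mul_cpow_ofReal_nonneg hu.1.le hy.le, add_sub_assoc,
      Complex.cpow_add _ _ (by exact_mod_cast hu.1.ne')]
    ring
  rw [h1, intervalIntegral.integral_const_mul, integral_cpow (Or.inl (by
    simp; linarith [k.cast_nonneg (α := ℝ)])), sub_add_cancel, Complex.ofReal_one,
    Complex.one_cpow, Complex.ofReal_zero, Complex.zero_cpow (critPt_add_natCast_ne_zero k x)]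
  ring

/-- The basic integral on the critical line, by writing `1 / (s + k)` as an integral of
`u^(s + k - 1)` over `[0, 1]` and applying Fubini. -/
lemma integral_cpow_div_mul_sechWeight (k : ℕ) {y : ℝ} (hy : 0 < y) :
    ∫ x : ℝ, (y : ℂ) ^ critPt x / (critPt x + k) * sechWeight x =
      ((2 * ∫ u in (0 : ℝ)..1, u ^ k * y / (1 + u * y) : ℝ) : ℂ) := by
  set F : ℝ → ℝ → ℂ := fun u x =>
    (u : ℂ) ^ ((k : ℂ) - 1) * ((u * y : ℝ) : ℂ) ^ critPt x * sechWeight x with hF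
  have hint : Integrable (Function.uncurry F)
      ((volume.restrict (Set.uIoc (0 : ℝ) 1)).prod volume) := by
    have hu : IntegrableOn (fun u : ℝ => u ^ ((k : ℝ) - 1 / 2)) (Set.uIoc 0 1) :=
      intervalIntegrable_iff.1 (intervalIntegral.intervalIntegrable_rpow' (by
        linarith [k.cast_nonneg (α := ℝ)]))
    have hprod := (Integrable.mul_prod hu integrable_sechWeight).const_mul (y ^ (1 / 2 : ℝ))
    refine hprod.mono' ?_ ?_
    · refine Measurable.aestronglyMeasurable ?_
      have := continuous_critPt.measurable
      have := continuous_sechWeight.measurable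
      simp only [hF, Function.uncurry_def]
      fun_prop
    · have hae : ∀ᵐ z : ℝ × ℝ ∂((volume.restrict (Set.uIoc (0 : ℝ) 1)).prod volume),
          z.1 ∈ Set.uIoc (0 : ℝ) 1 :=
        Measure.quasiMeasurePreserving_fst.ae (ae_restrict_mem measurableSet_uIoc)
      filter_upwards [hae] with z hz
      rw [Set.uIoc_of_le zero_le_one] at hz
      have hz0 := hz.1
      simp only [Function.uncurry, hF]
      rw [norm_mul, norm_mul, Complex.norm_cpow_eq_rpow_re_of_pos hz0,
        Complex.norm_cpow_eq_rpow_re_of_pos (by positivity), Complex.norm_real,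
        Real.norm_of_nonneg (sechWeight_pos _).le, critPt_re, Real.mul_rpow hz0.le hy.le]
      have : z.1 ^ ((k : ℝ) - 1 / 2) = z.1 ^ ((k : ℂ) - 1).re * z.1 ^ (1 / 2 : ℝ) := by
        rw [← Real.rpow_add hz0]
        congr 1
        simp
        ring
      rw [this]
      apply le_of_eq
      ring
  have hswap := intervalIntegral_integral_swap (f := F) (a := 0) (b := 1) (μ := volume) hint
  have hleft : ∀ x : ℝ, ∫ u in (0 : ℝ)..1, F u x =
      (y : ℂ) ^ critPt x / (critPt x + k) * sechWeight x := fun x => by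
    simp only [hF]
    rw [intervalIntegral.integral_mul_const, integral_cpow_critPt_add k x hy]
  simp only [hleft] at hswap
  rw [← hswap, ← intervalIntegral.integral_const_mul, ← intervalIntegral.integral_ofReal,
    intervalIntegral.integral_of_le zero_le_one, intervalIntegral.integral_of_le zero_le_one]
  refine setIntegral_congr_fun measurableSet_Ioc fun u hu => ?_
  have hu0 := hu.1
  simp only [hF, mul_assoc]
  rw [integral_const_mul]
  have := integral_cpow_mul_sechWeight (mul_pos hu0 hy)
  rw [this, Complex.cpow_sub _ _ (by exact_mod_cast hu0.ne'), Complex.cpow_natCast,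
    Complex.cpow_one]
  have h1 : (u : ℂ) ≠ 0 := by exact_mod_cast hu0.ne'
  push_cast
  field_simp

lemma norm_one_div_critPt_add_le (k : ℕ) (x : ℝ) : ‖(critPt x + k)⁻¹‖ ≤ 2 := by
  rw [norm_inv]
  have h1 : (1 : ℝ) / 2 ≤ ‖critPt x + k‖ := by
    refine le_trans ?_ (Complex.abs_re_le_norm _)
    simp
    rw [abs_of_nonneg (by positivity)]
    linarith [k.cast_nonneg (α := ℝ)]
  calc ‖critPt x + k‖⁻¹ ≤ (1 / 2)⁻¹ := inv_anti₀ (by norm_num) h1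
    _ = 2 := by norm_num

lemma norm_critPt_div_le (k : ℕ) (x : ℝ) : ‖critPt x / (critPt x + k)‖ ≤ 1 := by
  rw [norm_div, div_le_one (norm_pos_iff.2 (critPt_add_natCast_ne_zero k x)),
    Complex.norm_def, Complex.norm_def]
  apply Real.sqrt_le_sqrt
  simp only [Complex.normSq_apply, critPt, Complex.add_re, Complex.add_im, Complex.natCast_re,
    Complex.natCast_im, add_zero]
  simp
  nlinarith [k.cast_nonneg (α := ℝ)]

lemma integrable_mul_sechWeight {f : ℝ → ℂ} (hf : Continuous f) {C : ℝ} (hC : ∀ x, ‖f x‖ ≤ C) :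
    Integrable fun x : ℝ => f x * sechWeight x := by
  refine (integrable_sechWeight.const_mul C).mono'
    (hf.mul (Complex.continuous_ofReal.comp continuous_sechWeight)).aestronglyMeasurable
    (ae_of_all _ fun x => ?_)
  rw [norm_mul, Complex.norm_real, Real.norm_of_nonneg (sechWeight_pos x).le]
  exact mul_le_mul_of_nonneg_right (hC x) (sechWeight_pos x).le

lemma continuous_cpow_critPt {y : ℝ} (hy : 0 < y) : Continuous fun x => (y : ℂ) ^ critPt x :=
  continuous_critPt.const_cpow (Or.inl (by exact_mod_cast hy.ne'))

lemma norm_cpow_critPt {y : ℝ} (hy : 0 < y) (x : ℝ) : ‖(y : ℂ) ^ critPt x‖ = √y := by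
  rw [Complex.norm_cpow_eq_rpow_re_of_pos hy, critPt_re, Real.sqrt_eq_rpow]

lemma continuous_critPt_add_inv (k : ℕ) : Continuous fun x => (critPt x + k)⁻¹ :=
  (continuous_critPt.add continuous_const).inv₀ (critPt_add_natCast_ne_zero k)

lemma integrable_cpow_div_mul_sechWeight (k : ℕ) {y : ℝ} (hy : 0 < y) :
    Integrable fun x : ℝ => (y : ℂ) ^ critPt x / (critPt x + k) * sechWeight x := by
  simp only [div_eq_mul_inv]
  refine integrable_mul_sechWeight ((continuous_cpow_critPt hy).mul (continuous_critPt_add_inv k))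
    (C := √y * 2) fun x => ?_
  rw [norm_mul, norm_cpow_critPt hy]
  exact mul_le_mul_of_nonneg_left (norm_one_div_critPt_add_le k x) (Real.sqrt_nonneg _)

/-- `s ↦ 1 - s` reverses the critical line. -/
lemma critPt_neg (x : ℝ) : critPt (-x) = 1 - critPt x := by
  rw [critPt, critPt]; push_cast; ring

lemma integral_pow_div_one_add_div (k n : ℕ) :
    ∫ u in (0 : ℝ)..1, u ^ k * (1 / ((n : ℝ) + 1)) / (1 + u * (1 / ((n : ℝ) + 1))) =
      ∫ u in (0 : ℝ)..1, u ^ k / ((n : ℝ) + 1 + u) := by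
  refine intervalIntegral.integral_congr fun u hu => ?_
  rw [Set.uIcc_of_le zero_le_one] at hu
  have := hu.1
  have : (n : ℝ) + 1 + u ≠ 0 := by positivity
  field_simp

/-! ### Integrating `ζ` on the lines `Re s = 3/2` and `Re s = 1/2` -/

lemma succ_cpow_neg_eq (n : ℕ) (s : ℂ) :
    ((n : ℂ) + 1) ^ (-s) = ((1 / ((n : ℝ) + 1) : ℝ) : ℂ) ^ s := by
  have h : ((n : ℂ) + 1) = (((n : ℝ) + 1 : ℝ) : ℂ) := by push_cast; rfl
  have hpos : (0 : ℝ) < (n : ℝ) + 1 := by positivity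
  rw [one_div, Complex.ofReal_inv, Complex.inv_cpow _ _ (by
    rw [Complex.arg_ofReal_of_nonneg hpos.le]; exact Real.pi_pos.ne), Complex.cpow_neg, h]

lemma integral_succ_cpow_neg_div (k n : ℕ) :
    ∫ x : ℝ, ((n : ℂ) + 1) ^ (-critPt x) / (critPt x + k) * sechWeight x =
      ((2 * ∫ u in (0 : ℝ)..1, u ^ k / ((n : ℝ) + 1 + u) : ℝ) : ℂ) := by
  have hy : (0 : ℝ) < 1 / ((n : ℝ) + 1) := by positivity
  rw [← integral_pow_div_one_add_div, ← integral_cpow_div_mul_sechWeight k hy]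
  simp only [succ_cpow_neg_eq]

lemma integrable_succ_cpow_neg_div (k n : ℕ) :
    Integrable fun x : ℝ => ((n : ℂ) + 1) ^ (-critPt x) / (critPt x + k) * sechWeight x := by
  simp only [succ_cpow_neg_eq]
  exact integrable_cpow_div_mul_sechWeight k (by positivity)

lemma integral_pow_div_eq_mul_moment (p n : ℕ) :
    ∫ u in (0 : ℝ)..1, u ^ p / ((n : ℝ) + 1 + u) = (n + 1) * moment p n := by
  rw [moment, ← intervalIntegral.integral_const_mul]
  congr 1
  ext u
  rw [mul_div_assoc', mul_div_mul_left _ _ (by positivity)]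

lemma critPt_add_one_re (x : ℝ) : 1 < (critPt x + 1).re := by
  rw [Complex.add_re, critPt_re]; norm_num

lemma critPt_ne_one (x : ℝ) : critPt x ≠ 1 := fun h => by
  have := congrArg Complex.re h
  norm_num at this

lemma norm_succ_cpow (n : ℕ) (s : ℂ) : ‖((n : ℂ) + 1) ^ s‖ = ((n : ℝ) + 1) ^ s.re := by
  have h : ((n : ℂ) + 1) = (((n : ℝ) + 1 : ℝ) : ℂ) := by push_cast; rfl
  rw [h, Complex.norm_cpow_eq_rpow_re_of_pos (by positivity)]

/-- The sum of `(n + 1)^(-3/2)`, the common bound in the estimates of `ζ` below. -/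
noncomputable def threeHalvesSum : ℝ := ∑' n : ℕ, ((n : ℝ) + 1) ^ (-(3 / 2) : ℝ)

lemma norm_riemannZeta_critPt_add_one_le (x : ℝ) :
    ‖riemannZeta (critPt x + 1)‖ ≤ threeHalvesSum := by
  rw [← (hasSum_succ_cpow (critPt_add_one_re x)).tsum_eq]
  refine tsum_of_norm_bounded (summable_succ_rpow_neg (by norm_num)).hasSum fun n => ?_
  rw [norm_succ_cpow]
  simp
  norm_num

lemma continuous_riemannZeta_critPt_add_one :
    Continuous fun x => riemannZeta (critPt x + 1) :=
  continuous_iff_continuousAt.2 fun x => ContinuousAt.comp (f := fun x => critPt x + 1)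
    (differentiableAt_riemannZeta fun h => by
      have h1 := critPt_add_one_re x
      rw [h] at h1; simp at h1).continuousAt
    (continuous_critPt.add continuous_const).continuousAt

lemma integrable_riemannZeta_three_halves (p : ℕ) :
    Integrable fun x : ℝ => riemannZeta (critPt x + 1) / (critPt x + p) * sechWeight x := by
  simp only [div_eq_mul_inv]
  refine integrable_mul_sechWeight
    (continuous_riemannZeta_critPt_add_one.mul (continuous_critPt_add_inv p))
    (C := threeHalvesSum * 2) fun x => ?_
  rw [norm_mul]
  exact mul_le_mul (norm_riemannZeta_critPt_add_one_le x) (norm_one_div_critPt_add_le p x)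
    (norm_nonneg _) ((norm_nonneg _).trans (norm_riemannZeta_critPt_add_one_le x))

/-- On the line `Re s = 3/2` the Dirichlet series of `ζ` can be integrated term by term. -/
lemma integral_riemannZeta_three_halves (p : ℕ) :
    ∫ x : ℝ, riemannZeta (critPt x + 1) / (critPt x + p) * sechWeight x =
      2 * (nuReal p : ℂ) := by
  set F : ℕ → ℝ → ℂ := fun n x =>
    ((n : ℂ) + 1)⁻¹ * (((n : ℂ) + 1) ^ (-critPt x) / (critPt x + p) * sechWeight x) with hF
  have hint : ∀ n, Integrable (F n) := fun n => (integrable_succ_cpow_neg_div p n).const_mul _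
  have hval : ∀ n, ∫ x, F n x = ((2 * moment p n : ℝ) : ℂ) := by
    intro n
    simp only [hF]
    rw [integral_const_mul, integral_succ_cpow_neg_div, integral_pow_div_eq_mul_moment]
    push_cast
    have : (n : ℂ) + 1 ≠ 0 := by exact_mod_cast (Nat.succ_ne_zero n)
    field_simp
  have hterm : ∀ n x, F n x = ((n : ℂ) + 1) ^ (-(critPt x + 1)) *
      (sechWeight x / (critPt x + p)) := by
    intro n x
    have : (n : ℂ) + 1 ≠ 0 := by exact_mod_cast (Nat.succ_ne_zero n)
    rw [neg_add', Complex.cpow_sub _ _ this, Complex.cpow_one]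
    simp only [hF]
    ring
  have hnorm : ∀ n, ∫ x, ‖F n x‖ ≤
      ((n : ℝ) + 1) ^ (-(3 / 2) : ℝ) * (2 * ∫ x, sechWeight x) := by
    intro n
    rw [← integral_const_mul, ← integral_const_mul]
    refine integral_mono (hint n).norm ((integrable_sechWeight.const_mul _).const_mul _) fun x => ?_
    simp only [hterm]
    rw [norm_mul, norm_succ_cpow, div_eq_mul_inv, norm_mul, Complex.norm_real,
      Real.norm_of_nonneg (sechWeight_pos x).le]
    have h1 : (-(critPt x + 1)).re = -(3 / 2) := by simp; norm_num
    rw [h1]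
    refine mul_le_mul_of_nonneg_left ?_ (by positivity)
    rw [mul_comm]
    exact mul_le_mul_of_nonneg_right (norm_one_div_critPt_add_le p x) (sechWeight_pos x).le
  have hsum := hasSum_integral_of_summable_integral_norm hint
    (Summable.of_nonneg_of_le (fun n => integral_nonneg fun x => norm_nonneg _) hnorm
      ((summable_succ_rpow_neg (by norm_num)).mul_right _))
  have hpt : ∀ x, ∑' n, F n x = riemannZeta (critPt x + 1) / (critPt x + p) * sechWeight x := by
    intro x
    have h1 := ((hasSum_succ_cpow (critPt_add_one_re x)).mul_right
      (sechWeight x / (critPt x + p))).tsum_eq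
    simp only [← hterm] at h1
    rw [h1]
    ring
  simp only [hval, hpt] at hsum
  have h2 : HasSum (fun n => ((2 * moment p n : ℝ) : ℂ)) ((2 * nuReal p : ℝ) : ℂ) :=
    Complex.hasSum_ofReal.2 ((summable_moment p).hasSum.mul_left 2)
  rw [hsum.unique h2]
  push_cast
  rfl

/-- The continuation of `ζ` to `Re s > 0`, as the case `k = 1` of the continuation of
`momentSeries`. -/
lemma riemannZeta_eq_sub_momentSeries {s : ℂ} (hs : 0 < s.re) (hs1 : s ≠ 1) :
    riemannZeta s = s / (s - 1) - s * momentSeries 1 (s + 1) := by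
  have h := shiftProd_mul_momentSeries 1 (s := s + 1) (by simpa using hs)
  have h0 : s - 1 ≠ 0 := sub_ne_zero.2 hs1
  have h1 : shiftProd 1 (s + 1) = s * (s - 1) := by
    rw [shiftProd, prod_range_succ, prod_range_one]
    push_cast
    ring
  rw [h1, momentCont, momentCont, add_sub_cancel_right] at h
  simp only [shiftProdTail, shiftProd, range_zero, prod_empty, zero_add, prod_range_one,
    Nat.cast_zero] at h
  rw [riemannZeta_eq_inv_sub_mul hs1]
  field_simp
  linear_combination h

/-- The partial sum `∑_{n ≤ N + 1} n^(-s) - (N + 1)^(1 - s) / (1 - s)`, which tends to `ζ(s)` for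
`0 < Re s < 1`. -/
noncomputable def zetaPartial (N : ℕ) (s : ℂ) : ℂ :=
  ∑ n ∈ range (N + 1), ((n : ℂ) + 1) ^ (-s) - ((N : ℂ) + 1) ^ (1 - s) / (1 - s)

/-- Each step from `N` to `N + 1` is an integration by parts, so the increments of `zetaPartial`
are `-s` times the terms of `momentSeries 1 (s + 1)`. -/
lemma zetaPartial_eq (N : ℕ) {s : ℂ} (hs : s ≠ 1) :
    zetaPartial N s = s / (s - 1) - s * ∑ n ∈ range N, powMoment 1 n (s + 1) := by
  have h0 : s - 1 ≠ 0 := sub_ne_zero.2 hs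
  have h0' : 1 - s ≠ 0 := sub_ne_zero.2 hs.symm
  induction N with
  | zero =>
    simp [zetaPartial]
    field_simp
    ring
  | succ N ih =>
    have h1 := mul_powMoment_succ 0 N (s + 1)
    have h2 := mul_powMoment_zero N s
    rw [add_sub_cancel_right, show 1 - (s + 1) = -s by ring] at h1
    push_cast at h1
    have h3 : zetaPartial (N + 1) s = zetaPartial N s + ((N : ℂ) + 2) ^ (-s) -
        (((N : ℂ) + 2) ^ (1 - s) - ((N : ℂ) + 1) ^ (1 - s)) / (1 - s) := by
      rw [zetaPartial, zetaPartial, sum_range_succ _ (N + 1)]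
      push_cast
      rw [show (N : ℂ) + 1 + 1 = N + 2 by ring]
      ring
    rw [h3, ih, sum_range_succ, ← h2, mul_div_cancel_left₀ _ h0']
    linear_combination -h1

lemma norm_powMoment_critPt_le (n : ℕ) (x : ℝ) :
    ‖powMoment 1 n (critPt x + 1)‖ ≤ ((n : ℝ) + 1) ^ (-(3 / 2) : ℝ) := by
  refine (norm_powMoment_le 1 n (by linarith [critPt_add_one_re x])).trans_eq ?_
  congr 1
  rw [Complex.add_re, critPt_re]; norm_num

lemma norm_critPt_mul_div_le (k : ℕ) (x : ℝ) {S : ℂ} (hS : ‖S‖ ≤ threeHalvesSum) :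
    ‖(critPt x / (critPt x - 1) - critPt x * S) / (critPt x + k)‖ ≤ 2 + threeHalvesSum := by
  have h1 : (critPt x / (critPt x - 1) - critPt x * S) / (critPt x + k) =
      critPt x / (critPt x + k) * ((critPt x - 1)⁻¹ - S) := by ring
  have h2 : ‖(critPt x - 1)⁻¹‖ ≤ 2 := by
    have := norm_one_div_critPt_add_le 0 (-x)
    rw [critPt_neg] at this
    rwa [Nat.cast_zero, add_zero, ← norm_neg, ← inv_neg, neg_sub] at this
  rw [h1, norm_mul]
  calc _ ≤ 1 * ‖(critPt x - 1)⁻¹ - S‖ :=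
        mul_le_mul_of_nonneg_right (norm_critPt_div_le k x) (norm_nonneg _)
    _ ≤ 2 + threeHalvesSum := by
        rw [one_mul]
        exact (norm_sub_le _ _).trans (add_le_add h2 hS)

lemma norm_momentSeries_critPt_le (x : ℝ) :
    ‖momentSeries 1 (critPt x + 1)‖ ≤ threeHalvesSum :=
  tsum_of_norm_bounded (summable_succ_rpow_neg (by norm_num)).hasSum
    fun n => norm_powMoment_critPt_le n x

lemma norm_sum_powMoment_critPt_le (N : ℕ) (x : ℝ) :
    ‖∑ n ∈ range N, powMoment 1 n (critPt x + 1)‖ ≤ threeHalvesSum :=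
  (norm_sum_le_of_le _ fun n _ => norm_powMoment_critPt_le n x).trans
    ((summable_succ_rpow_neg (by norm_num)).sum_le_tsum _ fun n _ => by positivity)

lemma continuous_riemannZeta_critPt : Continuous fun x => riemannZeta (critPt x) :=
  continuous_iff_continuousAt.2 fun x => ContinuousAt.comp (f := critPt)
    (differentiableAt_riemannZeta (critPt_ne_one x)).continuousAt continuous_critPt.continuousAt

lemma integrable_riemannZeta_half (k : ℕ) :
    Integrable fun x : ℝ => riemannZeta (critPt x) / (critPt x + k) * sechWeight x := by
  refine integrable_mul_sechWeight (f := fun x => riemannZeta (critPt x) / (critPt x + k))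
    (C := 2 + threeHalvesSum) ?_ fun x => ?_
  · simp only [div_eq_mul_inv]
    exact continuous_riemannZeta_critPt.mul (continuous_critPt_add_inv k)
  · rw [riemannZeta_eq_sub_momentSeries (by rw [critPt_re]; norm_num) (critPt_ne_one x)]
    exact norm_critPt_mul_div_le k x (norm_momentSeries_critPt_le x)

/-- Partial fractions for `1 / ((1 - s) (s + k))`, with `1 - s` read as the reflected point. -/
lemma succ_cpow_one_sub_div (k N : ℕ) (x : ℝ) :
    ((N : ℂ) + 1) ^ (1 - critPt x) / (1 - critPt x) / (critPt x + k) =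
      1 / ((k : ℂ) + 1) * ((((N : ℝ) + 1 : ℝ) : ℂ) ^ critPt (-x) / (critPt (-x) + (0 : ℕ)) +
        ((N : ℂ) + 1) * (((N : ℂ) + 1) ^ (-critPt x) / (critPt x + k))) := by
  have h1 := critPt_add_natCast_ne_zero k x
  have h2 : 1 - critPt x ≠ 0 := sub_ne_zero.2 (critPt_ne_one x).symm
  have h3 : (k : ℂ) + 1 ≠ 0 := by exact_mod_cast (Nat.succ_ne_zero k)
  have h4 : (N : ℂ) + 1 ≠ 0 := by exact_mod_cast (Nat.succ_ne_zero N)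
  have h5 : ((N : ℂ) + 1) * ((N : ℂ) + 1) ^ (-critPt x) = ((N : ℂ) + 1) ^ (1 - critPt x) := by
    rw [sub_eq_add_neg, Complex.cpow_add _ _ h4, Complex.cpow_one]
  rw [mul_div_assoc', h5, critPt_neg]
  push_cast
  rw [add_zero]
  field_simp
  ring

/-- The last two terms come from `(N + 1)^(1 - s) / (1 - s)`; they supply `-ln (N + 2)`, which turns
the harmonic sum into `γ`, and the constant `-2 / (k + 1)²` in the limit. -/
lemma integral_zetaPartial (k N : ℕ) :
    ∫ x : ℝ, zetaPartial N (critPt x) / (critPt x + k) * sechWeight x =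
      ((2 * (harmonic (N + 1) / (k + 1) - ∑ n ∈ range (N + 1), moment (k + 1) n) -
        1 / (k + 1) * (2 * Real.log (N + 2) +
          (N + 1) * (2 * ∫ u in (0 : ℝ)..1, u ^ k / ((N : ℝ) + 1 + u))) : ℝ) : ℂ) := by
  have hy : (0 : ℝ) < (N : ℝ) + 1 := by positivity
  set A : ℝ → ℂ := fun x =>
    (((N : ℝ) + 1 : ℝ) : ℂ) ^ critPt (-x) / (critPt (-x) + (0 : ℕ)) * sechWeight (-x) with hA
  have hAint : Integrable A := (integrable_cpow_div_mul_sechWeight 0 hy).comp_neg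
  have hAval : ∫ x, A x = ((2 * Real.log (N + 2) : ℝ) : ℂ) := by
    have h1 := integral_neg_eq_self (fun x : ℝ =>
      (((N : ℝ) + 1 : ℝ) : ℂ) ^ critPt x / (critPt x + (0 : ℕ)) * sechWeight x) volume
    rw [hA, h1, integral_cpow_div_mul_sechWeight 0 hy]
    congr 2
    simp only [pow_zero, one_mul]
    have h2 := intervalIntegral.integral_eq_sub_of_hasDerivAt (a := (0 : ℝ)) (b := 1)
      (f := fun u : ℝ => Real.log (1 + u * ((N : ℝ) + 1)))
      (f' := fun u : ℝ => ((N : ℝ) + 1) / (1 + u * ((N : ℝ) + 1)))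
      (fun u hu => by
        rw [Set.uIcc_of_le zero_le_one] at hu
        have hu0 := hu.1
        have h3 : HasDerivAt (fun u : ℝ => 1 + u * ((N : ℝ) + 1)) ((N : ℝ) + 1) u := by
          simpa using ((hasDerivAt_id u).mul_const ((N : ℝ) + 1)).const_add 1
        exact h3.log (by positivity))
      (by
        apply ContinuousOn.intervalIntegrable
        rw [Set.uIcc_of_le zero_le_one]
        refine ContinuousOn.div (by fun_prop) (by fun_prop) fun u hu => ?_
        have hu0 := hu.1
        positivity)
    rw [h2, one_mul, zero_mul, add_zero, Real.log_one, sub_zero]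
    congr 1
    ring
  have hdec : ∀ x : ℝ, zetaPartial N (critPt x) / (critPt x + k) * sechWeight x =
      ∑ n ∈ range (N + 1), ((n : ℂ) + 1) ^ (-critPt x) / (critPt x + k) * sechWeight x -
      1 / ((k : ℂ) + 1) * (A x +
        ((N : ℂ) + 1) * (((N : ℂ) + 1) ^ (-critPt x) / (critPt x + k) * sechWeight x)) := by
    intro x
    rw [zetaPartial, sub_div, succ_cpow_one_sub_div, sub_mul, Finset.sum_div, Finset.sum_mul]
    simp only [hA, sechWeight_neg]
    ring
  simp only [hdec]
  have hI := fun n => integrable_succ_cpow_neg_div k n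
  have hB : Integrable fun x : ℝ => 1 / ((k : ℂ) + 1) * (A x +
      ((N : ℂ) + 1) * (((N : ℂ) + 1) ^ (-critPt x) / (critPt x + k) * sechWeight x)) :=
    (hAint.add ((hI N).const_mul _)).const_mul _
  rw [integral_sub (integrable_finsetSum _ fun n _ => hI n) hB,
    integral_finsetSum _ fun n _ => hI n,
    integral_const_mul, integral_add hAint ((hI N).const_mul _), integral_const_mul, hAval]
  simp only [integral_succ_cpow_neg_div]
  have h5 : ∑ n ∈ range (N + 1), ∫ u in (0 : ℝ)..1, u ^ k / ((n : ℝ) + 1 + u) =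
      harmonic (N + 1) / (k + 1) - ∑ n ∈ range (N + 1), moment (k + 1) n := by
    rw [harmonic_eq_sum_range, Finset.sum_div, ← sum_sub_distrib]
    refine sum_congr rfl fun n _ => ?_
    rw [moment_succ]
    ring
  rw [← h5, Finset.mul_sum]
  push_cast
  rfl

/-- Dominated convergence along `zetaPartial`, which is `O(|s|)` uniformly on the critical line: the
factor `|s|` is absorbed by `1 / |s + k|`. -/
lemma integral_riemannZeta_half (k : ℕ) :
    ∫ x : ℝ, riemannZeta (critPt x) / (critPt x + k) * sechWeight x =
      2 * (-1 / ((k : ℂ) + 1) ^ 2 + (Real.eulerMascheroniConstant : ℂ) / ((k : ℂ) + 1) -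
            nuReal (k + 1)) := by
  have hlim1 : Tendsto
      (fun N => ∫ x : ℝ, zetaPartial N (critPt x) / (critPt x + k) * sechWeight x) atTop
      (𝓝 (∫ x : ℝ, riemannZeta (critPt x) / (critPt x + k) * sechWeight x)) := by
    refine tendsto_integral_of_dominated_convergence
      (fun x => (2 + threeHalvesSum) * sechWeight x) (fun N => ?_)
      (integrable_sechWeight.const_mul _) (fun N => ae_of_all _ fun x => ?_)
      (ae_of_all _ fun x => ?_)
    · have hc1 := continuous_critPt
      have hc2 := continuous_sechWeight
      refine Continuous.aestronglyMeasurable ?_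
      refine Continuous.mul (Continuous.div ?_ (by fun_prop) (critPt_add_natCast_ne_zero k))
        (by fun_prop)
      refine Continuous.sub (continuous_finsetSum _ fun n _ => ?_) (Continuous.div ?_ (by fun_prop)
        fun x => sub_ne_zero.2 (critPt_ne_one x).symm)
      · exact Continuous.const_cpow (by fun_prop) (Or.inl (by exact_mod_cast (Nat.succ_ne_zero n)))
      · exact Continuous.const_cpow (by fun_prop) (Or.inl (by exact_mod_cast (Nat.succ_ne_zero N)))
    · rw [norm_mul, Complex.norm_real, Real.norm_of_nonneg (sechWeight_pos x).le,
        zetaPartial_eq N (critPt_ne_one x)]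
      exact mul_le_mul_of_nonneg_right
        (norm_critPt_mul_div_le k x (norm_sum_powMoment_critPt_le N x)) (sechWeight_pos x).le
    · refine Tendsto.mul_const _ (Tendsto.div_const ?_ _)
      simp only [zetaPartial_eq _ (critPt_ne_one x)]
      rw [riemannZeta_eq_sub_momentSeries (by rw [critPt_re]; norm_num) (critPt_ne_one x)]
      exact ((summable_powMoment 1 (critPt_add_one_re x)).hasSum.tendsto_sum_nat.const_mul _
        ).const_sub _
  simp only [integral_zetaPartial] at hlim1
  have hk : (k : ℝ) + 1 ≠ 0 := by positivity
  have hrem : Tendsto (fun N : ℕ => ((N : ℝ) + 1) *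
      ∫ u in (0 : ℝ)..1, u ^ k / ((N : ℝ) + 1 + u)) atTop (𝓝 (1 / (k + 1))) := by
    have h1 : Tendsto (fun N : ℕ => ((N : ℝ) + 1) * moment (k + 1) N) atTop (𝓝 0) := by
      refine squeeze_zero (fun N => mul_nonneg (by positivity) (moment_nonneg _ _)) (fun N => ?_)
        tendsto_one_div_add_atTop_nhds_zero_nat
      calc ((N : ℝ) + 1) * moment (k + 1) N ≤ ((N : ℝ) + 1) * (1 / ((N : ℝ) + 1) ^ 2) :=
            mul_le_mul_of_nonneg_left (moment_le_sq _ _) (by positivity)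
        _ = 1 / ((N : ℝ) + 1) := by field_simp
    have h2 := h1.const_sub (1 / ((k : ℝ) + 1))
    rw [sub_zero] at h2
    refine h2.congr fun N => ?_
    rw [moment_succ]
    field_simp
    ring
  have hγ : Tendsto (fun N : ℕ => (harmonic (N + 1) : ℝ) - Real.log (N + 2)) atTop
      (𝓝 Real.eulerMascheroniConstant) := by
    refine (Real.tendsto_harmonic_sub_log_add_one.comp (tendsto_add_atTop_nat 1)).congr fun N => ?_
    simp only [Function.comp_apply]
    push_cast
    rw [show (N : ℝ) + 1 + 1 = N + 2 by ring]
  have hν := (summable_moment (k + 1)).hasSum.tendsto_sum_nat.comp (tendsto_add_atTop_nat 1)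
  have hlim2 := (((hγ.div_const ((k : ℝ) + 1)).sub hν).const_mul 2).sub
    ((hrem.const_mul 2).const_mul (1 / ((k : ℝ) + 1)))
  have hlim3 := (Complex.continuous_ofReal.tendsto _).comp hlim2
  rw [tendsto_nhds_unique hlim1 (hlim3.congr fun N => ?_), ← nuReal]
  · push_cast
    have : (k : ℂ) + 1 ≠ 0 := by exact_mod_cast (Nat.succ_ne_zero k)
    field_simp
    ring
  · simp only [Function.comp_apply]
    congr 1
    field_simp
    ring

/-! ### Both signs, and the first values of `ν_k` -/

lemma integrable_comp_sign {ε : ℝ} (hε : ε = 1 ∨ ε = -1) {f : ℝ → ℂ} (hf : Integrable f) :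
    Integrable fun x => f (ε * x) := by
  rcases hε with rfl | rfl
  · simpa using hf
  · simpa using hf.comp_neg

lemma integral_comp_sign {ε : ℝ} (hε : ε = 1 ∨ ε = -1) (f : ℝ → ℂ) :
    ∫ x, f (ε * x) = ∫ x, f x := by
  rcases hε with rfl | rfl
  · simp
  · simpa using integral_neg_eq_self f volume

lemma sechWeight_sign {ε : ℝ} (hε : ε = 1 ∨ ε = -1) (x : ℝ) :
    sechWeight (ε * x) = sechWeight x := by
  rcases hε with rfl | rfl
  · simp
  · simpa using sechWeight_neg x

lemma kernel_half {ε : ℝ} (hε : ε = 1 ∨ ε = -1) (k : ℕ) :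
    kernel (1 / 2) ε k = fun x =>
      riemannZeta (critPt (ε * x)) / (critPt (ε * x) + k) * sechWeight (ε * x) := by
  ext x
  have h : (((1 / 2 : ℝ) : ℂ) + Complex.I * ε * x) = critPt (ε * x) := by
    rw [critPt]; push_cast; ring
  rw [kernel, h, sechWeight_sign hε, ← inv_cosh_eq_sechWeight, div_mul_eq_div_div,
    div_eq_mul_inv _ (Complex.cosh _)]

lemma kernel_three_halves {ε : ℝ} (hε : ε = 1 ∨ ε = -1) (p : ℕ) :
    kernel (3 / 2) ε (((p : ℤ) - 1 : ℤ) : ℂ) = fun x =>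
      riemannZeta (critPt (ε * x) + 1) / (critPt (ε * x) + p) * sechWeight (ε * x) := by
  ext x
  have h : (((3 / 2 : ℝ) : ℂ) + Complex.I * ε * x) = critPt (ε * x) + 1 := by
    rw [critPt]; push_cast; ring
  rw [kernel, h, sechWeight_sign hε, ← inv_cosh_eq_sechWeight, div_mul_eq_div_div,
    div_eq_mul_inv _ (Complex.cosh _)]
  push_cast
  rw [show critPt (ε * x) + 1 + ((p : ℂ) - 1) = critPt (ε * x) + p by ring]

lemma integrable_kernel_half {ε : ℝ} (hε : ε = 1 ∨ ε = -1) (k : ℕ) :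
    Integrable (kernel (1 / 2) ε k) := by
  rw [kernel_half hε]
  exact integrable_comp_sign hε (integrable_riemannZeta_half k)

lemma integral_kernel_half {ε : ℝ} (hε : ε = 1 ∨ ε = -1) (k : ℕ) :
    ∫ x : ℝ, kernel (1 / 2) ε k x =
      2 * (-1 / ((k : ℂ) + 1) ^ 2 + (Real.eulerMascheroniConstant : ℂ) / ((k : ℂ) + 1) -
        nuReal (k + 1)) := by
  rw [kernel_half hε, ← integral_riemannZeta_half]
  exact integral_comp_sign hε fun x => riemannZeta (critPt x) / (critPt x + k) * sechWeight x

lemma integrable_kernel_three_halves {ε : ℝ} (hε : ε = 1 ∨ ε = -1) (p : ℕ) :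
    Integrable (kernel (3 / 2) ε (((p : ℤ) - 1 : ℤ) : ℂ)) := by
  rw [kernel_three_halves hε]
  exact integrable_comp_sign hε (integrable_riemannZeta_three_halves p)

lemma integral_kernel_three_halves {ε : ℝ} (hε : ε = 1 ∨ ε = -1) (p : ℕ) :
    ∫ x : ℝ, kernel (3 / 2) ε (((p : ℤ) - 1 : ℤ) : ℂ) x = 2 * (nuReal p : ℂ) := by
  rw [kernel_three_halves hε, ← integral_riemannZeta_three_halves]
  exact integral_comp_sign hε fun x => riemannZeta (critPt x + 1) / (critPt x + p) * sechWeight x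

lemma nuReal_two :
    nuReal 2 = Real.eulerMascheroniConstant / 2 + 1 - Real.log (2 * Real.pi) / 2 := by
  have h := nuReal_closed_form 1 le_rfl
  have hlog : Complex.log (2 * Real.pi) = (Real.log (2 * Real.pi) : ℂ) := by
    rw [Complex.ofReal_log (by positivity)]; push_cast; rfl
  rw [sum_range_one] at h
  simp only [Nat.cast_zero, neg_zero, deriv_riemannZeta_zero, hlog] at h
  apply Complex.ofReal_injective
  rw [h]
  push_cast
  simp
  ring

/-- The case `k = 2` of the closed form also shows that `ζ'(-1)` is real. -/
lemma nuReal_three : nuReal 3 = Real.eulerMascheroniConstant / 3 + 2 / 3 -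
    Real.log (2 * Real.pi) / 2 - 2 * (deriv riemannZeta (-1)).re := by
  have h := nuReal_closed_form 2 one_le_two
  have hlog : Complex.log (2 * Real.pi) = (Real.log (2 * Real.pi) : ℂ) := by
    rw [Complex.ofReal_log (by positivity)]; push_cast; rfl
  have hz : riemannZeta (-1) = -1 / 12 := by
    have := riemannZeta_neg_nat_eq_bernoulli 1
    norm_num [bernoulli_two] at this
    rw [this]; norm_num
  rw [sum_range_succ, sum_range_one] at h
  simp only [Nat.cast_zero, Nat.cast_one, neg_zero, deriv_riemannZeta_zero, hlog, hz] at h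
  norm_num [harmonic] at h
  have hd : deriv riemannZeta (-1) = (((Real.eulerMascheroniConstant / 3 + 2 / 3 -
      Real.log (2 * Real.pi) / 2 - nuReal 3) / 2 : ℝ) : ℂ) := by
    push_cast
    linear_combination (1 / 2) * h
  rw [hd, Complex.ofReal_re]
  ring

end ZetaSeries

theorem mainTheorem3 :
    -- the constants involved are given by convergent series and limits
    (∀ k : ℤ, -1 ≤ k →
      Filter.Tendsto (ZetaSeries.nuPartial k) Filter.atTop (nhds (ZetaSeries.nu k))) ∧
    Filter.Tendsto (ZetaSeries.stieltjesSeq 1) Filter.atTop (nhds (ZetaSeries.stieltjes 1)) ∧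
    Summable (fun n : ℕ => |ZetaSeries.gregory (n + 1)| / ((n : ℝ) + 1) ^ 2) ∧
    -- closed forms of `ν_k`, `k = 0, 1, 2, …`
    ZetaSeries.nu 0 = (Real.eulerMascheroniConstant : ℂ) ∧
    (∀ k : ℕ, 1 ≤ k →
      ZetaSeries.nu k = (Real.eulerMascheroniConstant : ℂ) / ((k : ℂ) + 1) + 1 / (k : ℂ) +
        ∑ m ∈ Finset.range k, (-1 : ℂ) ^ m * (k.choose m : ℂ) *
          (deriv riemannZeta (-(m : ℂ)) + ((harmonic m : ℚ) : ℂ) * riemannZeta (-(m : ℂ)))) ∧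
    -- the integrals, for each choice of the sign
    (∀ ε : ℝ, ε = 1 ∨ ε = -1 →
      (∀ k : ℕ,
        MeasureTheory.Integrable (ZetaSeries.kernel (1 / 2) ε k) ∧
        ∫ x : ℝ, ZetaSeries.kernel (1 / 2) ε k x =
          2 * (-1 / ((k : ℂ) + 1) ^ 2 + (Real.eulerMascheroniConstant : ℂ) / ((k : ℂ) + 1) -
            ZetaSeries.nu k)) ∧
      (∀ k : ℤ, -1 ≤ k →
        MeasureTheory.Integrable (ZetaSeries.kernel (3 / 2) ε k) ∧
        ∫ x : ℝ, ZetaSeries.kernel (3 / 2) ε k x = 2 * ZetaSeries.nu k) ∧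
      ∫ x : ℝ, riemannZeta (1 / 2 + Complex.I * ε * x) /
          ((1 / 2 + Complex.I * ε * x) * Complex.cosh (Real.pi * x)) = -2 ∧
      ∫ x : ℝ, riemannZeta (1 / 2 + Complex.I * ε * x) /
          ((3 / 2 + Complex.I * ε * x) * Complex.cosh (Real.pi * x)) =
        ((Real.log (2 * Real.pi) - 5 / 2 : ℝ) : ℂ) ∧
      ∫ x : ℝ, riemannZeta (1 / 2 + Complex.I * ε * x) /
          ((5 / 2 + Complex.I * ε * x) * Complex.cosh (Real.pi * x)) =
        ((Real.log (2 * Real.pi) - 4 * Real.log ZetaSeries.glaisherKinkelin - 11 / 9 : ℝ) : ℂ) ∧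
      ∫ x : ℝ, riemannZeta (3 / 2 + Complex.I * ε * x) /
          ((3 / 2 + Complex.I * ε * x) * Complex.cosh (Real.pi * x)) =
        ((2 * Real.eulerMascheroniConstant : ℝ) : ℂ) ∧
      ∫ x : ℝ, riemannZeta (3 / 2 + Complex.I * ε * x) /
          ((1 / 2 + Complex.I * ε * x) * Complex.cosh (Real.pi * x)) =
        2 * ∫ x in (0 : ℝ)..1,
          (Complex.digamma ((x : ℂ) + 1) + (Real.eulerMascheroniConstant : ℂ)) / (x : ℂ)) ∧
    -- the last integral in terms of the constants
    IntervalIntegrable (fun x : ℝ =>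
      (Complex.digamma ((x : ℂ) + 1) + (Real.eulerMascheroniConstant : ℂ)) / (x : ℂ))
      MeasureTheory.volume 0 1 ∧
    2 * ∫ x in (0 : ℝ)..1,
        (Complex.digamma ((x : ℂ) + 1) + (Real.eulerMascheroniConstant : ℂ)) / (x : ℂ) =
      ((2 * ZetaSeries.kappaOne + Real.pi ^ 2 / 6 - Real.eulerMascheroniConstant ^ 2 -
        2 * ZetaSeries.stieltjes 1 : ℝ) : ℂ) := by
  have h1 : ZetaSeries.nu 0 = (Real.eulerMascheroniConstant : ℂ) := by
    have := ZetaSeries.nu_natCast 0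
    rwa [zero_add, ZetaSeries.nuReal_one, Nat.cast_zero] at this
  refine ⟨fun k hk => ?_, ?_, ZetaSeries.summable_gregory_div_sq, h1, fun k hk => ?_,
    fun ε hε => ⟨fun k => ⟨ZetaSeries.integrable_kernel_half hε k, ?_⟩, fun k hk => ?_,
      ?_, ?_, ?_, ?_, ?_⟩, ZetaSeries.intervalIntegrable_digamma_add_div, ?_⟩
  · obtain ⟨p, hp⟩ := Int.eq_ofNat_of_zero_le (show 0 ≤ k + 1 by omega)
    obtain rfl : k = (p : ℤ) - 1 := by omega
    rw [ZetaSeries.nu_sub_one]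
    exact ZetaSeries.tendsto_nuPartial p
  · rw [ZetaSeries.stieltjes_one_eq]
    exact ZetaSeries.tendsto_stieltjesSeq_one ZetaSeries.hasSum_log_div_nuReal_zero
  · rw [ZetaSeries.nu_natCast]
    exact ZetaSeries.nuReal_closed_form k hk
  · rw [ZetaSeries.integral_kernel_half hε, ZetaSeries.nu_natCast]
  · obtain ⟨p, hp⟩ := Int.eq_ofNat_of_zero_le (show 0 ≤ k + 1 by omega)
    obtain rfl : k = (p : ℤ) - 1 := by omega
    rw [ZetaSeries.nu_sub_one]
    exact ⟨ZetaSeries.integrable_kernel_three_halves hε p,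
      ZetaSeries.integral_kernel_three_halves hε p⟩
  · have h := ZetaSeries.integral_kernel_half hε 0
    rw [zero_add, ZetaSeries.nuReal_one] at h
    simp only [ZetaSeries.kernel] at h
    push_cast at h
    simp only [add_zero, zero_add] at h
    rw [h]
    ring
  · have h := ZetaSeries.integral_kernel_half hε 1
    rw [ZetaSeries.nuReal_two] at h
    simp only [ZetaSeries.kernel] at h
    push_cast at h
    have e : ∀ x : ℝ, (1 / 2 + Complex.I * ε * x + 1 : ℂ) = 3 / 2 + Complex.I * ε * x :=
      fun x => by ring
    simp only [e] at h
    rw [h]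
    push_cast
    ring
  · have h := ZetaSeries.integral_kernel_half hε 2
    rw [ZetaSeries.nuReal_three] at h
    simp only [ZetaSeries.kernel] at h
    push_cast at h
    have e : ∀ x : ℝ, (1 / 2 + Complex.I * ε * x + 2 : ℂ) = 5 / 2 + Complex.I * ε * x :=
      fun x => by ring
    simp only [e] at h
    rw [h, ZetaSeries.glaisherKinkelin, Real.log_exp]
    push_cast
    ring
  · have h := ZetaSeries.integral_kernel_three_halves hε 1
    rw [ZetaSeries.nuReal_one] at h
    simp only [ZetaSeries.kernel] at h
    push_cast at h
    simp only [add_zero] at h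
    rw [h]
    push_cast
    ring
  · have h := ZetaSeries.integral_kernel_three_halves hε 0
    simp only [ZetaSeries.kernel] at h
    push_cast at h
    have e : ∀ x : ℝ, (3 / 2 + Complex.I * ε * x + -1 : ℂ) = 1 / 2 + Complex.I * ε * x :=
      fun x => by ring
    simp only [e] at h
    rw [h, ZetaSeries.integral_digamma_add_div]
  · rw [ZetaSeries.integral_digamma_add_div, ZetaSeries.stieltjes_one_eq]
    push_cast
    ring
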